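/- A locally $C^*$-algebra is a complete Hausdorff topological complex $*$-algebra $A$ (not necessarily unital) whose topology is defined by an upward directed family $\Gamma$ of $C^*$-seminorms, i.e. seminorms $p$ with $p(ab)\le p(a)p(b)$ and $p(a^*a)=p(a)^2$; it is called Fréchet if its topology is given by a countable family of $C^*$-seminorms. A continuous linear functional $f:A\to\mathbb{C}$ is positive if $f(a^*a)\ge 0$ for all $a\in A$. A continuous positive functional $f$ is pure if $f\neq 0$ and every positive functional $g$ with $g(a^*a)\le f(a^*a)$ for all $a\in A$ is of the form $g=\alpha f$ with $\alpha\in[0,1]$. The algebra $A$ is scattered if every continuous positive functional on $A$ is a countable (finite, possibly empty, or infinite) sum, in the sense of pointwise convergence, of pure functionals on $A$. **Proposition.** Let $A$ be a locally $C^*$-algebra and let $I$ be a closed two-sided $*$-ideal of $A$. Let $A/I$ carry the quotient topology and let $\overline{A/I}$ be its completion. Then $I$ and $\overline{A/I}$ are locally $C^*$-algebras, and $$A \text{ is scattered} \iff I \text{ and } \overline{A/I} \text{ are scattered}.$$ If moreover $A$ is a Fréchet locally $C^*$-algebra, then $A/I$ is already complete and is a Fréchet locally $C^*$-algebra, and $A$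 is scattered if and only if $I$ and $A/I$ are scattered. -/

import Mathlib

open scoped ComplexOrder

noncomputable section

/-- A complex topological `*`-algebra, not necessarily unital. -/
class IsTopologicalStarAlgebra (A : Type*) [NonUnitalRing A] [StarRing A] [Module ℂ A]
    [UniformSpace A] : Prop extends IsScalarTower ℂ A A, SMulCommClass ℂ A A, StarModule ℂ A,
    IsUniformAddGroup A, ContinuousSMul ℂ A, ContinuousMul A, ContinuousStar A

/-- A `C*`-seminorm on a complex `*`-algebra. -/
structure IsCStarSeminorm {A : Type*} [NonUnitalRing A] [StarRing A] [Module ℂ A]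
    (p : Seminorm ℂ A) : Prop where
  mul_le : ∀ a b : A, p (a * b) ≤ p a * p b
  star_mul_self : ∀ a : A, p (star a * a) = p a ^ 2

/-- A locally `C*`-algebra: a complete Hausdorff topological `*`-algebra whose topology is defined
by an upward directed family `Γ` of `C*`-seminorms. -/
class IsLocallyCStarAlgebra (A : Type*) [NonUnitalRing A] [StarRing A] [Module ℂ A]
    [UniformSpace A] : Prop extends IsTopologicalStarAlgebra A, CompleteSpace A, T2Space A where
  exists_seminorms : ∃ Γ : Set (Seminorm ℂ A), Γ.Nonempty ∧ DirectedOn (· ≤ ·) Γ ∧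
    (∀ p ∈ Γ, IsCStarSeminorm p) ∧ WithSeminorms (fun p : Γ => (p : Seminorm ℂ A))

/-- A Fréchet locally `C*`-algebra: the topology is given by a countable family of
`C*`-seminorms. -/
class IsFrechetLocallyCStarAlgebra (A : Type*) [NonUnitalRing A] [StarRing A] [Module ℂ A]
    [UniformSpace A] : Prop extends IsLocallyCStarAlgebra A where
  exists_seq : ∃ p : ℕ → Seminorm ℂ A, (∀ n, IsCStarSeminorm (p n)) ∧ WithSeminorms p

section Functionals

variable {A : Type*} [NonUnitalRing A] [StarRing A] [Module ℂ A] [TopologicalSpace A]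

/-- A continuous linear functional `f` is positive if `f (a* a) ≥ 0` for all `a`. -/
def IsPositiveFunctional (f : A →L[ℂ] ℂ) : Prop :=
  ∀ a : A, 0 ≤ f (star a * a)

/-- A pure functional: a nonzero continuous positive functional `f` such that every positive
functional `g ≤ f` is of the form `α f` with `α ∈ [0, 1]`. -/
def IsPureFunctional (f : A →L[ℂ] ℂ) : Prop :=
  IsPositiveFunctional f ∧ f ≠ 0 ∧
    ∀ g : A →L[ℂ] ℂ, IsPositiveFunctional g → (∀ a : A, g (star a * a) ≤ f (star a * a)) →
      ∃ α ∈ Set.Icc (0 : ℝ) 1, ∀ a : A, g a = (α : ℂ) * f a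

variable (A) in
/-- Every continuous positive functional is a countable (finite, possibly empty, or infinite) sum
of pure functionals, in the pointwise convergence. -/
def IsScattered : Prop :=
  ∀ f : A →L[ℂ] ℂ, IsPositiveFunctional f →
    ∃ (ι : Type) (_ : Countable ι) (g : ι → A →L[ℂ] ℂ),
      (∀ i, IsPureFunctional (g i)) ∧ ∀ a : A, HasSum (fun i => g i a) (f a)

end Functionals

/-- A closed two-sided `*`-ideal. -/
structure ClosedStarIdeal (A : Type*) [NonUnitalRing A] [StarRing A] [Module ℂ A]
    [TopologicalSpace A] extends NonUnitalStarSubalgebra ℂ A where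
  mul_mem_left : ∀ (a : A) {x : A}, x ∈ carrier → a * x ∈ carrier
  mul_mem_right : ∀ {x : A} (a : A), x ∈ carrier → x * a ∈ carrier
  isClosed : IsClosed carrier

namespace ClosedStarIdeal

variable {A : Type*} [NonUnitalRing A] [StarRing A] [Module ℂ A]

section Algebra

variable [TopologicalSpace A]

/-- The ideal as a linear subspace. -/
def toSubspace (I : ClosedStarIdeal A) : Submodule ℂ A :=
  I.toNonUnitalSubalgebra.toSubmodule

/-- The quotient `*`-algebra `A / I`. -/
def Quotient (I : ClosedStarIdeal A) : Type _ := A ⧸ I.toSubspace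

variable (I : ClosedStarIdeal A)

instance : AddCommGroup I.Quotient := inferInstanceAs (AddCommGroup (A ⧸ I.toSubspace))

instance : Module ℂ I.Quotient := inferInstanceAs (Module ℂ (A ⧸ I.toSubspace))

/-- The quotient topology. -/
instance : TopologicalSpace I.Quotient := inferInstanceAs (TopologicalSpace (A ⧸ I.toSubspace))

/-- The quotient map `A → A / I`. -/
def proj : A →ₗ[ℂ] I.Quotient := I.toSubspace.mkQ

variable {I} in
theorem proj_eq_proj {a b : A} : I.proj a = I.proj b ↔ a - b ∈ I.toSubspace :=
  Submodule.Quotient.eq _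

theorem proj_surjective : Function.Surjective I.proj := Submodule.mkQ_surjective _

theorem isOpenQuotientMap_proj [IsTopologicalAddGroup A] : IsOpenQuotientMap I.proj :=
  QuotientAddGroup.isOpenQuotientMap_mk (N := I.toSubspace.toAddSubgroup)

/-- Multiplication on `A / I`, determined by `proj a * proj b = proj (a * b)`. -/
instance : Mul I.Quotient where
  mul := Quotient.map₂ (· * ·) (by
    intro a a' ha b b' hb
    have ha : a - a' ∈ I.toSubspace := (Submodule.quotientRel_def _).1 ha
    have hb : b - b' ∈ I.toSubspace := (Submodule.quotientRel_def _).1 hb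
    refine (Submodule.quotientRel_def _).2 ?_
    have h : a * b - a' * b' = (a - a') * b + a' * (b - b') := by
      rw [sub_mul, mul_sub]; abel
    rw [h]
    exact I.toSubspace.add_mem (I.mul_mem_right _ ha) (I.mul_mem_left _ hb))

theorem proj_mul (a b : A) : I.proj (a * b) = I.proj a * I.proj b := rfl

instance : NonUnitalRing I.Quotient :=
  { (inferInstance : AddCommGroup I.Quotient), (inferInstance : Mul I.Quotient) with
    left_distrib := fun x y z => by
      obtain ⟨a, rfl⟩ := I.proj_surjective x
      obtain ⟨b, rfl⟩ := I.proj_surjective y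
      obtain ⟨c, rfl⟩ := I.proj_surjective z
      rw [← map_add, ← proj_mul, ← proj_mul, ← proj_mul, mul_add, map_add]
    right_distrib := fun x y z => by
      obtain ⟨a, rfl⟩ := I.proj_surjective x
      obtain ⟨b, rfl⟩ := I.proj_surjective y
      obtain ⟨c, rfl⟩ := I.proj_surjective z
      rw [← map_add, ← proj_mul, ← proj_mul, ← proj_mul, add_mul, map_add]
    zero_mul := fun x => by
      obtain ⟨a, rfl⟩ := I.proj_surjective x
      rw [← map_zero I.proj, ← proj_mul, zero_mul]
    mul_zero := fun x => by
      obtain ⟨a, rfl⟩ := I.proj_surjective x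
      rw [← map_zero I.proj, ← proj_mul, mul_zero]
    mul_assoc := fun x y z => by
      obtain ⟨a, rfl⟩ := I.proj_surjective x
      obtain ⟨b, rfl⟩ := I.proj_surjective y
      obtain ⟨c, rfl⟩ := I.proj_surjective z
      rw [← proj_mul, ← proj_mul, ← proj_mul, ← proj_mul, mul_assoc] }

/-- The involution on `A / I`, determined by `star (proj a) = proj (star a)`. -/
instance : Star I.Quotient where
  star := Quotient.map star (by
    intro a b h
    have h : a - b ∈ I.toSubspace := (Submodule.quotientRel_def _).1 h
    refine (Submodule.quotientRel_def _).2 ?_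
    rw [← star_sub]
    exact I.star_mem' h)

theorem proj_star (a : A) : I.proj (star a) = star (I.proj a) := rfl

instance : StarRing I.Quotient where
  star_involutive x := by
    obtain ⟨a, rfl⟩ := I.proj_surjective x
    rw [← proj_star, ← proj_star, star_star]
  star_mul x y := by
    obtain ⟨a, rfl⟩ := I.proj_surjective x
    obtain ⟨b, rfl⟩ := I.proj_surjective y
    rw [← proj_mul, ← proj_star, star_mul, proj_mul, proj_star, proj_star]
  star_add x y := by
    obtain ⟨a, rfl⟩ := I.proj_surjective x
    obtain ⟨b, rfl⟩ := I.proj_surjective y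
    rw [← map_add, ← proj_star, star_add, map_add, proj_star, proj_star]

end Algebra

variable [UniformSpace A] [IsTopologicalStarAlgebra A] (I : ClosedStarIdeal A)

instance : IsTopologicalAddGroup I.Quotient :=
  inferInstanceAs (IsTopologicalAddGroup (A ⧸ I.toSubspace))

/-- The uniform structure of the topological group `A / I`; its topology is, definitionally, the
quotient topology. -/
instance : UniformSpace I.Quotient :=
  (IsTopologicalAddGroup.rightUniformSpace I.Quotient).replaceTopology rfl

instance : IsTopologicalStarAlgebra I.Quotient where
  smul_assoc c x y := by
    obtain ⟨a, rfl⟩ := I.proj_surjective x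
    obtain ⟨b, rfl⟩ := I.proj_surjective y
    simp only [smul_eq_mul]
    rw [← map_smul, ← proj_mul, ← proj_mul, ← map_smul, smul_mul_assoc]
  smul_comm c x y := by
    obtain ⟨a, rfl⟩ := I.proj_surjective x
    obtain ⟨b, rfl⟩ := I.proj_surjective y
    simp only [smul_eq_mul]
    rw [← map_smul, ← proj_mul, ← proj_mul, ← map_smul, mul_smul_comm]
  star_smul c x := by
    obtain ⟨a, rfl⟩ := I.proj_surjective x
    rw [← map_smul, ← proj_star, star_smul, map_smul, proj_star]
  uniformContinuous_sub :=
    (isUniformAddGroup_of_addCommGroup (G := I.Quotient)).uniformContinuous_sub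
  continuous_smul := by
    refine ((IsOpenQuotientMap.id (X := ℂ)).prodMap
      I.isOpenQuotientMap_proj).isQuotientMap.continuous_iff.2 ?_
    exact I.isOpenQuotientMap_proj.continuous.comp continuous_smul
  continuous_mul := by
    refine (I.isOpenQuotientMap_proj.prodMap
      I.isOpenQuotientMap_proj).isQuotientMap.continuous_iff.2 ?_
    exact I.isOpenQuotientMap_proj.continuous.comp continuous_mul
  continuous_star := by
    refine I.isOpenQuotientMap_proj.isQuotientMap.continuous_iff.2 ?_
    exact I.isOpenQuotientMap_proj.continuous.comp continuous_star

end ClosedStarIdeal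

/-- The Hausdorff completion of a topological `*`-algebra. -/
def StarCompletion (B : Type*) [UniformSpace B] : Type _ := UniformSpace.Completion B

namespace StarCompletion

open UniformSpace UniformSpace.Completion

variable (B : Type*) [NonUnitalRing B] [StarRing B] [Module ℂ B] [UniformSpace B]

instance : UniformSpace (StarCompletion B) := inferInstanceAs (UniformSpace (Completion B))

instance : CompleteSpace (StarCompletion B) := inferInstanceAs (CompleteSpace (Completion B))

instance : T2Space (StarCompletion B) := inferInstanceAs (T2Space (Completion B))

variable [IsTopologicalStarAlgebra B]

instance : UniformContinuousConstSMul ℂ B := uniformContinuousConstSMul_of_continuousConstSMul _ _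

instance : AddCommGroup (StarCompletion B) := inferInstanceAs (AddCommGroup (Completion B))

instance : IsUniformAddGroup (StarCompletion B) :=
  inferInstanceAs (IsUniformAddGroup (Completion B))

/-- Scalar multiplication on the completion, extended by continuity. -/
@[irreducible] def smulExtend (c : ℂ) (x : StarCompletion B) : StarCompletion B :=
  (c • (show Completion B from x) : Completion B)

instance : SMul ℂ (StarCompletion B) := ⟨smulExtend B⟩

set_option linter.unusedSectionVars false in
theorem smul_eq_extend (c : ℂ) (x : StarCompletion B) :
    c • x = (c • (show Completion B from x) : Completion B) := by
  change smulExtend B c x = _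
  rw [smulExtend]

instance : Module ℂ (StarCompletion B) where
  one_smul x := by rw [smul_eq_extend]; exact one_smul ℂ (show Completion B from x)
  mul_smul c d x := by
    rw [smul_eq_extend B c (d • x), smul_eq_extend B d x, smul_eq_extend]
    exact mul_smul c d (show Completion B from x)
  smul_zero c := by rw [smul_eq_extend]; exact smul_zero (A := Completion B) c
  smul_add c x y := by
    simp only [smul_eq_extend]; exact smul_add c (show Completion B from x) y
  add_smul c d x := by
    simp only [smul_eq_extend]; exact add_smul c d (show Completion B from x)
  zero_smul x := by rw [smul_eq_extend]; exact zero_smul ℂ (show Completion B from x)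

instance : ContinuousConstSMul ℂ (StarCompletion B) where
  continuous_const_smul c := by
    simp only [smul_eq_extend]
    exact continuous_const_smul (T := Completion B) c

/-- The canonical map of `B` into its completion. -/
def of : B →+ StarCompletion B := toCompl

theorem isDenseInducing_of : IsDenseInducing (of B) := isDenseInducing_toCompl B

theorem of_smul (c : ℂ) (b : B) : of B (c • b) = c • of B b := by
  rw [smul_eq_extend]
  exact coe_smul c b

theorem continuous_of : Continuous (of B) := (isDenseInducing_of B).continuous

/-- Multiplication, extended by continuity. -/
@[irreducible] def mulExtend (x y : StarCompletion B) : StarCompletion B :=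
  ((isDenseInducing_of B).prodMap (isDenseInducing_of B)).extend
    (fun p : B × B => of B (p.1 * p.2)) (x, y)

instance : Mul (StarCompletion B) := ⟨mulExtend B⟩

theorem mul_eq_extend (x y : StarCompletion B) :
    x * y = ((isDenseInducing_of B).prodMap (isDenseInducing_of B)).extend
      (fun p : B × B => of B (p.1 * p.2)) (x, y) := by
  change mulExtend B x y = _
  rw [mulExtend]

/-- The involution, extended by continuity. -/
@[irreducible] def starExtend (x : StarCompletion B) : StarCompletion B :=
  (isDenseInducing_of B).extend (fun b : B => of B (star b)) x

instance : Star (StarCompletion B) := ⟨starExtend B⟩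

theorem star_eq_extend (x : StarCompletion B) :
    star x = (isDenseInducing_of B).extend (fun b : B => of B (star b)) x := by
  change starExtend B x = _
  rw [starExtend]

variable {B}

theorem of_mul (a b : B) : of B (a * b) = of B a * of B b := by
  rw [mul_eq_extend]
  exact (((isDenseInducing_of B).prodMap (isDenseInducing_of B)).extend_eq
    ((continuous_of B).comp continuous_mul) (a, b)).symm

instance : ContinuousMul (StarCompletion B) where
  continuous_mul := by
    let m := (AddMonoidHom.mul : B →+ B →+ B).compr₂ (of B)
    have h : Continuous fun p : B × B => m p.1 p.2 := (continuous_of B).comp continuous_mul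
    simp only [mul_eq_extend]
    exact ((isDenseInducing_of B).extend_Z_bilin (isDenseInducing_of B) h :)

theorem of_star (b : B) : of B (star b) = star (of B b) := by
  rw [star_eq_extend]
  exact ((isDenseInducing_of B).extend_eq ((continuous_of B).comp continuous_star) b).symm

instance : ContinuousStar (StarCompletion B) where
  continuous_star := by
    have h : UniformContinuous ((of B).comp (starAddEquiv : B ≃+ B).toAddMonoidHom) :=
      uniformContinuous_addMonoidHom_of_continuous ((continuous_of B).comp continuous_star)
    rw [show (star : StarCompletion B → StarCompletion B) =
      (isDenseInducing_of B).extend (fun b : B => of B (star b)) from funext (star_eq_extend B)]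
    exact (uniformContinuous_uniformly_extend
      (isUniformInducing_coe B) (isDenseInducing_of B).dense h).continuous

instance : NonUnitalRing (StarCompletion B) :=
  { (inferInstance : AddCommGroup (StarCompletion B)),
    (inferInstance : Mul (StarCompletion B)) with
    left_distrib := fun x y z => by
      refine Completion.induction_on₃ x y z (isClosed_eq (by fun_prop) (by fun_prop))
        (p := fun x y z : StarCompletion B => x * (y + z) = x * y + x * z) fun a b c => ?_
      change of B a * (of B b + of B c) = of B a * of B b + of B a * of B c
      rw [← map_add, ← of_mul, ← of_mul, ← of_mul, mul_add, map_add]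
    right_distrib := fun x y z => by
      refine Completion.induction_on₃ x y z (isClosed_eq (by fun_prop) (by fun_prop))
        (p := fun x y z : StarCompletion B => (x + y) * z = x * z + y * z) fun a b c => ?_
      change (of B a + of B b) * of B c = of B a * of B c + of B b * of B c
      rw [← map_add, ← of_mul, ← of_mul, ← of_mul, add_mul, map_add]
    zero_mul := fun x => by
      refine Completion.induction_on x (isClosed_eq (by fun_prop) (by fun_prop))
        (p := fun x : StarCompletion B => 0 * x = 0) fun a => ?_
      change 0 * of B a = 0
      rw [← map_zero (of B), ← of_mul, zero_mul]
    mul_zero := fun x => by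
      refine Completion.induction_on x (isClosed_eq (by fun_prop) (by fun_prop))
        (p := fun x : StarCompletion B => x * 0 = 0) fun a => ?_
      change of B a * 0 = 0
      rw [← map_zero (of B), ← of_mul, mul_zero]
    mul_assoc := fun x y z => by
      refine Completion.induction_on₃ x y z (isClosed_eq (by fun_prop) (by fun_prop))
        (p := fun x y z : StarCompletion B => x * y * z = x * (y * z)) fun a b c => ?_
      change of B a * of B b * of B c = of B a * (of B b * of B c)
      rw [← of_mul, ← of_mul, ← of_mul, ← of_mul, mul_assoc] }

instance : StarRing (StarCompletion B) where
  star_involutive x := by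
    refine Completion.induction_on x (isClosed_eq (by fun_prop) (by fun_prop))
      (p := fun x : StarCompletion B => star (star x) = x) fun a => ?_
    change star (star (of B a)) = of B a
    rw [← of_star, ← of_star, star_star]
  star_mul x y := by
    refine Completion.induction_on₂ x y (isClosed_eq (by fun_prop) (by fun_prop))
      (p := fun x y : StarCompletion B => star (x * y) = star y * star x) fun a b => ?_
    change star (of B a * of B b) = star (of B b) * star (of B a)
    rw [← of_mul, ← of_star, star_mul, of_mul, of_star, of_star]
  star_add x y := by
    refine Completion.induction_on₂ x y (isClosed_eq (by fun_prop) (by fun_prop))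
      (p := fun x y : StarCompletion B => star (x + y) = star x + star y) fun a b => ?_
    change star (of B a + of B b) = star (of B a) + star (of B b)
    rw [← map_add, ← of_star, star_add, map_add, of_star, of_star]

end StarCompletion

end

open scoped ComplexOrder

set_option linter.unusedSectionVars false

/-! The key fact is that a positive functional `g` on the ideal `I` has a smallest positive
extension `F` to `A`: `F` lies below every positive functional on `A` that dominates `g` on `I`
(`exists_extension`). In GNS language, `g` is represented by a vector `ξ` and `F a = ⟨ξ, a ξ⟩`. No
Hilbert space is built. Instead, elements `y` of `I` that almost minimise `g (y* y) - 2 Re g y`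
replace `ξ`, and `F a` is a limit of `g (y* a y)`.

Minimality makes the extension of a pure functional pure, and makes a nonzero restriction of a pure
functional pure. For a positive `f` on a scattered extension, decompose `f` on `I` into pure `g i`.
By minimality the finite sums of their extensions `F i` stay below `f`, so they converge to some `G
≤ f` with `f - G` zero on `I`. Then `f - G` descends to the quotient, where it is decomposed and
pulled back. Conversely, a functional on `I` is extended, decomposed and restricted. A functional on
the quotient is pulled back and decomposed, and each summand vanishes on `I` because it is dominated
by a functional vanishing there.

The analytic input is `|h x|² ≤ C h (x* x)`, with one constant for all `h ≤ f`, and the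
`C*`-identity for quotient seminorms. Both come from approximate units `1 - (1 - z* z) ^ n`. These
are polynomials without constant term, so they stay in the given `*`-subalgebra, and their estimates
follow from functional calculus in the `C*`-completion for a single seminorm. -/

noncomputable section

/-! ### Polynomial approximate units: estimates in a `C*`-algebra -/

section ApproximateUnit

/-- The elements `1 - (1 - b) ^ n`, written without a unit. -/
def oneSubPow {A : Type*} [NonUnitalRing A] (b : A) : ℕ → A
  | 0 => 0
  | n + 1 => oneSubPow b n + b - b * oneSubPow b n

/-- The recursion is `1 - w' = (1 - b) (1 - w)` expanded so that no unit occurs. -/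
theorem coe_oneSubPow {E : Type*} [NonUnitalCStarAlgebra E] (b : E) (n : ℕ) :
    ((oneSubPow b n : E) : Unitization ℂ E) = 1 - (1 - (b : Unitization ℂ E)) ^ n := by
  induction n with
  | zero => simp [oneSubPow]
  | succ n ih =>
    rw [oneSubPow, Unitization.inr_sub, Unitization.inr_add, Unitization.inr_mul, ih, pow_succ']
    noncomm_ring

/-- Bernoulli gives `1 + (m + 1) t ≤ (1 + t) ^ (m + 1)`, and `(1 + t) (1 - t) ≤ 1`. -/
theorem mul_one_sub_pow_le {t : ℝ} (h0 : 0 ≤ t) (h1 : t ≤ 1) (m : ℕ) :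
    (m + 1 : ℝ) * (t * (1 - t) ^ (m + 1)) ≤ 1 := by
  have hb : 1 + ((m + 1 : ℕ) : ℝ) * t ≤ (1 + t) ^ (m + 1) :=
    one_add_mul_le_pow (by linarith) _
  have hp : 0 ≤ (1 - t) ^ (m + 1) := pow_nonneg (by linarith) _
  have h2 : (1 + t) ^ (m + 1) * (1 - t) ^ (m + 1) ≤ 1 := by
    rw [← mul_pow]
    exact pow_le_one₀ (by nlinarith) (by nlinarith)
  have h3 := mul_le_mul_of_nonneg_right hb hp
  push_cast at h3
  nlinarith

theorem norm_one_sub_pow_estimates {U : Type*} [CStarAlgebra U] (x : U) (hx : ‖x‖ ≤ 1) (n : ℕ) :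
    ‖(1 - star x * x) ^ n‖ ≤ 1 ∧ ‖1 - (1 - star x * x) ^ n‖ ≤ 1 ∧
      ∀ m : ℕ, (m + 1 : ℝ) * ‖star x * x * (1 - star x * x) ^ (m + 1)‖ ≤ 1 := by
  let _ := CStarAlgebra.spectralOrder U
  have := CStarAlgebra.spectralOrderedRing U
  cases subsingleton_or_nontrivial U
  · have h : ∀ y : U, ‖y‖ = 0 := fun y => by rw [Subsingleton.elim y 0, norm_zero]
    simp [h]
  set b := star x * x with hb
  have hb0 : 0 ≤ b := star_mul_self_nonneg x
  have hsa : IsSelfAdjoint b := .of_nonneg hb0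
  have hb1 : ‖b‖ ≤ 1 := by
    rw [hb, CStarRing.norm_star_mul_self]; nlinarith [norm_nonneg x]
  have hs : ∀ t ∈ spectrum ℝ b, 0 ≤ t ∧ t ≤ 1 := fun t ht =>
    ⟨spectrum_nonneg_of_nonneg hb0 ht,
      ((le_abs_self t).trans (spectrum.norm_le_norm_of_mem ht)).trans hb1⟩
  have e1 : ∀ k : ℕ, cfc (fun t : ℝ => (1 - t) ^ k) b = (1 - b) ^ k := fun k => by
    rw [cfc_pow (fun t : ℝ => 1 - t) k b, cfc_sub (fun _ : ℝ => 1) (fun t => t) b, cfc_const_one ℝ b,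
      cfc_id' ℝ b]
  refine ⟨?_, ?_, fun m => ?_⟩
  · rw [← e1]
    refine norm_cfc_le zero_le_one fun t ht => ?_
    obtain ⟨h0, h1⟩ := hs t ht
    rw [Real.norm_eq_abs, abs_of_nonneg (pow_nonneg (by linarith) _)]
    exact pow_le_one₀ (by linarith) (by linarith)
  · have : cfc (fun t : ℝ => 1 - (1 - t) ^ n) b = 1 - (1 - b) ^ n := by
      rw [cfc_sub (fun _ : ℝ => 1) (fun t => (1 - t) ^ n) b, cfc_const_one ℝ b, e1]
    rw [← this]
    refine norm_cfc_le zero_le_one fun t ht => ?_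
    obtain ⟨h0, h1⟩ := hs t ht
    have h2 : (1 - t) ^ n ≤ 1 := pow_le_one₀ (by linarith) (by linarith)
    have h3 : 0 ≤ (1 - t) ^ n := pow_nonneg (by linarith) _
    rw [Real.norm_eq_abs, abs_of_nonneg (by linarith)]
    linarith
  · have : cfc (fun t : ℝ => t * (1 - t) ^ (m + 1)) b = b * (1 - b) ^ (m + 1) := by
      rw [cfc_mul (fun t : ℝ => t) (fun t => (1 - t) ^ (m + 1)) b, cfc_id' ℝ b, e1]
    rw [← this, mul_comm, ← le_div_iff₀ (by positivity)]
    refine norm_cfc_le (by positivity) fun t ht => ?_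
    obtain ⟨h0, h1⟩ := hs t ht
    rw [Real.norm_eq_abs, abs_of_nonneg (mul_nonneg h0 (pow_nonneg (by linarith) _)),
      le_div_iff₀ (by positivity), mul_comm]
    exact mul_one_sub_pow_le h0 h1 m

/-- With `w = 1 - c ^ n` in the unitization, `x - x w = x c ^ n`, and the `C*`-identity turns its
squared norm into `‖x* x c ^ (2 n)‖ ≤ 1 / (2 n)`. The stated bound gives away the factor `2`. -/
theorem norm_oneSubPow_estimates {E : Type*} [NonUnitalCStarAlgebra E] (x : E) (hx : ‖x‖ ≤ 1)
    (n : ℕ) :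
    ‖oneSubPow (star x * x) n‖ ≤ 1 ∧ (∀ y : E, ‖y - oneSubPow (star x * x) n * y‖ ≤ ‖y‖) ∧
      (n : ℝ) * ‖x - x * oneSubPow (star x * x) n‖ ^ 2 ≤ 1 := by
  have hX : ‖(x : Unitization ℂ E)‖ ≤ 1 := by rwa [Unitization.norm_inr]
  obtain ⟨h1, h2, h3⟩ := norm_one_sub_pow_estimates (x : Unitization ℂ E) hX n
  set X := (x : Unitization ℂ E) with hXdef
  have hw : ((oneSubPow (star x * x) n : E) : Unitization ℂ E) = 1 - (1 - star X * X) ^ n := by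
    rw [coe_oneSubPow, Unitization.inr_mul, Unitization.inr_star]
  refine ⟨?_, fun y => ?_, ?_⟩
  · rwa [← Unitization.norm_inr (𝕜 := ℂ), hw]
  · rw [← Unitization.norm_inr (𝕜 := ℂ), ← Unitization.norm_inr (𝕜 := ℂ) (a := y),
      Unitization.inr_sub, Unitization.inr_mul, hw, sub_mul, one_mul, sub_sub_cancel]
    exact (norm_mul_le _ _).trans (mul_le_of_le_one_left (norm_nonneg _) h1)
  · rcases n with _ | n
    · simp
    rw [← Unitization.norm_inr (𝕜 := ℂ), Unitization.inr_sub, Unitization.inr_mul, hw, mul_sub,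
      mul_one, sub_sub_cancel, sq, ← CStarRing.norm_star_mul_self]
    set c := 1 - star X * X with hc
    have hcs : star c = c := by simp [hc]
    have hcomm : Commute c (star X * X) := by
      rw [hc]; exact (Commute.one_left _).sub_left (Commute.refl _)
    have : star (X * c ^ (n + 1)) * (X * c ^ (n + 1)) = star X * X * c ^ ((n + n + 1) + 1) := by
      rw [star_mul, star_pow, hcs, mul_assoc, ← mul_assoc (star X), ← mul_assoc,
        (hcomm.pow_left (n + 1)).eq, mul_assoc, ← pow_add]
      congr 2; omega
    rw [this]
    refine le_trans ?_ (h3 (n + n + 1))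
    gcongr
    push_cast; linarith

end ApproximateUnit

/-! ### The completion is a topological `*`-algebra -/

namespace StarCompletion

open UniformSpace

variable {B : Type*} [NonUnitalRing B] [StarRing B] [Module ℂ B] [UniformSpace B]
  [IsTopologicalStarAlgebra B]

theorem induction_on {P : StarCompletion B → Prop} (x : StarCompletion B)
    (hP : IsClosed {x | P x}) (h : ∀ b : B, P (of B b)) : P x :=
  Completion.induction_on x hP h

theorem induction_on₂ {P : StarCompletion B → StarCompletion B → Prop} (x y : StarCompletion B)
    (hP : IsClosed {z : StarCompletion B × StarCompletion B | P z.1 z.2})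
    (h : ∀ a b : B, P (of B a) (of B b)) : P x y :=
  Completion.induction_on₂ x y hP h

/-- Joint continuity is obtained by viewing scalar multiplication as a continuous biadditive map on
`ℂ × B` and extending it, with `ℂ` dense in itself via the identity. -/
theorem continuous_smul_pair :
    Continuous fun z : ℂ × StarCompletion B => z.1 • z.2 := by
  let m : ℂ →+ B →+ StarCompletion B :=
    (smulAddHom ℂ B).compr₂ (of B)
  have h : Continuous fun z : ℂ × B => m z.1 z.2 := (continuous_of B).comp continuous_smul
  have hid : IsDenseInducing (AddMonoidHom.id ℂ) :=
    ⟨Topology.IsInducing.id, denseRange_id⟩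
  have hc := hid.extend_Z_bilin (isDenseInducing_of B) h
  convert hc using 1
  ext ⟨c, x⟩
  refine induction_on x (isClosed_eq (continuous_const_smul c)
    (hc.comp (Continuous.prodMk_right c))) fun b => ?_
  have h2 := (hid.prodMap (isDenseInducing_of B)).extend_eq h (c, b)
  refine Eq.trans ?_ h2.symm
  exact (of_smul B c b).symm

instance : IsTopologicalStarAlgebra (StarCompletion B) where
  smul_assoc c x y := by
    refine induction_on₂ (P := fun x y => (c • x) * y = c • (x * y)) x y
      (isClosed_eq (by fun_prop) (by fun_prop)) fun a b => ?_
    simp only [← of_smul, ← of_mul, smul_mul_assoc]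
  smul_comm c x y := by
    refine induction_on₂ (P := fun x y => c • (x * y) = x * (c • y)) x y
      (isClosed_eq (by fun_prop) (by fun_prop)) fun a b => ?_
    simp only [← of_smul, ← of_mul, mul_smul_comm]
  star_smul c x := by
    refine induction_on (P := fun x => star (c • x) = star c • star x) x
      (isClosed_eq (by fun_prop) (by fun_prop)) fun b => ?_
    simp only [← of_smul, ← of_star, star_smul]
  uniformContinuous_sub := uniformContinuous_sub
  continuous_smul := continuous_smul_pair
  continuous_mul := continuous_mul
  continuous_star := continuous_star

end StarCompletion

/-! ### Approximate units for a `C*`-seminorm -/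

section ApproximateUnit

variable {A : Type*} [NonUnitalRing A] [StarRing A] [Module ℂ A]

/-- Cancel `p a` in `p a ^ 2 = p (a* a) ≤ p a* · p a`, then exchange `a` and `a*`. -/
theorem IsCStarSeminorm.map_star {p : Seminorm ℂ A} (hp : IsCStarSeminorm p) (a : A) :
    p (star a) = p a := by
  have key : ∀ a : A, p a ≤ p (star a) := fun a => by
    rcases (apply_nonneg p a).eq_or_lt with h | h
    · rw [← h]; exact apply_nonneg _ _
    · have h1 := hp.star_mul_self a ▸ hp.mul_le (star a) a
      rw [sq] at h1
      exact le_of_mul_le_mul_right h1 h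
  exact le_antisymm (by simpa using key (star a)) (key a)

/-- The algebra `A`, as a seminormed space under `p`. -/
@[nolint unusedArguments]
def SeminormedCopy (_p : Seminorm ℂ A) : Type _ := A

namespace SeminormedCopy

variable (p : Seminorm ℂ A)

instance : NonUnitalRing (SeminormedCopy p) := inferInstanceAs (NonUnitalRing A)
instance : StarRing (SeminormedCopy p) := inferInstanceAs (StarRing A)
instance : Module ℂ (SeminormedCopy p) := inferInstanceAs (Module ℂ A)
instance : SeminormedAddCommGroup (SeminormedCopy p) :=
  AddGroupSeminorm.toSeminormedAddCommGroup (E := SeminormedCopy p)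
    (show Seminorm ℂ (SeminormedCopy p) from p).toAddGroupSeminorm

instance : NormedSpace ℂ (SeminormedCopy p) where
  norm_smul_le c a := (map_smul_eq_mul p c a).le

variable [IsScalarTower ℂ A A] [SMulCommClass ℂ A A] [StarModule ℂ A]

theorem isTopologicalStarAlgebra (hp : IsCStarSeminorm p) :
    IsTopologicalStarAlgebra (SeminormedCopy p) :=
  { toIsScalarTower := inferInstanceAs (IsScalarTower ℂ A A)
    toSMulCommClass := inferInstanceAs (SMulCommClass ℂ A A)
    toStarModule := inferInstanceAs (StarModule ℂ A)
    toIsUniformAddGroup := inferInstance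
    toContinuousSMul := inferInstance
    toContinuousMul :=
      { continuous_mul := by
          let R : NonUnitalSeminormedRing (SeminormedCopy p) :=
            { (inferInstance : NonUnitalRing (SeminormedCopy p)),
              (inferInstance : SeminormedAddCommGroup (SeminormedCopy p)) with
              norm_mul_le := hp.mul_le }
          exact (inferInstance : ContinuousMul (SeminormedCopy p)).continuous_mul }
    toContinuousStar :=
      { continuous_star := by
          refine (AddMonoidHomClass.isometry_of_norm
            (starAddEquiv : SeminormedCopy p ≃+ SeminormedCopy p) fun a => ?_).continuous
          exact hp.map_star a } }

end SeminormedCopy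

universe u

open UniformSpace in
/-- A `*`-algebra with a `C*`-seminorm maps isometrically into a `C*`-algebra. -/
theorem exists_isometric_cStarAlgebra {A : Type u} [NonUnitalRing A] [StarRing A] [Module ℂ A]
    [IsScalarTower ℂ A A] [SMulCommClass ℂ A A] [StarModule ℂ A]
    {p : Seminorm ℂ A} (hp : IsCStarSeminorm p) :
    ∃ (E : Type u) (_ : NonUnitalCStarAlgebra E) (φ : A → E),
      (∀ a b, φ (a + b) = φ a + φ b) ∧ (∀ a b, φ (a - b) = φ a - φ b) ∧
      (∀ a b, φ (a * b) = φ a * φ b) ∧ (∀ a, φ (star a) = star (φ a)) ∧ ∀ a, ‖φ a‖ = p a := by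
  have := SeminormedCopy.isTopologicalStarAlgebra p hp
  let N : NormedAddCommGroup (StarCompletion (SeminormedCopy p)) :=
    inferInstanceAs (NormedAddCommGroup (Completion (SeminormedCopy p)))
  have hnorm : ∀ a : SeminormedCopy p, ‖StarCompletion.of (SeminormedCopy p) a‖ = p a := fun a =>
    Completion.norm_coe a
  let R : NonUnitalNormedRing (StarCompletion (SeminormedCopy p)) :=
    { (inferInstance : NonUnitalRing (StarCompletion (SeminormedCopy p))), N with
      norm_mul_le := fun x y => by
        refine Completion.induction_on₂ x y (isClosed_le (by fun_prop) (by fun_prop))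
          (p := fun x y : StarCompletion (SeminormedCopy p) => ‖x * y‖ ≤ ‖x‖ * ‖y‖) fun a b => ?_
        change ‖StarCompletion.of (SeminormedCopy p) a * StarCompletion.of (SeminormedCopy p) b‖ ≤
          ‖StarCompletion.of (SeminormedCopy p) a‖ * ‖StarCompletion.of (SeminormedCopy p) b‖
        rw [← StarCompletion.of_mul, hnorm, hnorm, hnorm]
        exact hp.mul_le a b }
  have hC : CStarRing (StarCompletion (SeminormedCopy p)) :=
    { norm_mul_self_le := fun x => by
        refine Completion.induction_on x (isClosed_le (by fun_prop) (by fun_prop))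
          (p := fun x : StarCompletion (SeminormedCopy p) => ‖x‖ * ‖x‖ ≤ ‖star x * x‖) fun a => ?_
        change ‖StarCompletion.of (SeminormedCopy p) a‖ * ‖StarCompletion.of (SeminormedCopy p) a‖ ≤
          ‖star (StarCompletion.of (SeminormedCopy p) a) * StarCompletion.of (SeminormedCopy p) a‖
        rw [← StarCompletion.of_star, ← StarCompletion.of_mul, hnorm, hnorm, ← sq]
        exact (hp.star_mul_self a).ge }
  let S : NormedSpace ℂ (StarCompletion (SeminormedCopy p)) :=
    { (inferInstance : Module ℂ (StarCompletion (SeminormedCopy p))) with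
      norm_smul_le := fun c x => by
        refine Completion.induction_on x (isClosed_le (by fun_prop) (by fun_prop))
          (p := fun x : StarCompletion (SeminormedCopy p) => ‖c • x‖ ≤ ‖c‖ * ‖x‖) fun a => ?_
        change ‖c • StarCompletion.of (SeminormedCopy p) a‖ ≤
          ‖c‖ * ‖StarCompletion.of (SeminormedCopy p) a‖
        rw [← StarCompletion.of_smul, hnorm, hnorm]
        exact (map_smul_eq_mul p c a).le }
  refine ⟨StarCompletion (SeminormedCopy p), { R, S with
    toStarRing := inferInstance
    toCompleteSpace := inferInstance
    toCStarRing := hC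
    smul_assoc := smul_assoc
    smul_comm := smul_comm
    star_smul := star_smul }, fun a => StarCompletion.of (SeminormedCopy p) a,
    map_add (StarCompletion.of (SeminormedCopy p)), map_sub (StarCompletion.of (SeminormedCopy p)),
    StarCompletion.of_mul (B := SeminormedCopy p), StarCompletion.of_star (B := SeminormedCopy p),
    hnorm⟩

/-- Commutation with `b` is carried along in the induction because the involution reverses the
product in the recursion. -/
theorem star_oneSubPow {A : Type*} [NonUnitalRing A] [StarRing A] {b : A} (hb : star b = b) (n : ℕ) :
    star (oneSubPow b n) = oneSubPow b n ∧ oneSubPow b n * b = b * oneSubPow b n := by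
  induction n with
  | zero => simp [oneSubPow]
  | succ n ih =>
    obtain ⟨h1, h2⟩ := ih
    constructor
    · rw [oneSubPow, star_sub, star_add, star_mul, hb, h1, h2]
    · rw [oneSubPow]; simp only [sub_mul, add_mul, mul_sub, mul_add, h2, mul_assoc]

/-- Approximate units inside the `*`-ideal generated by an element. -/
theorem IsCStarSeminorm.exists_approximateUnit [IsScalarTower ℂ A A] [SMulCommClass ℂ A A]
    [StarModule ℂ A] {p : Seminorm ℂ A} (hp : IsCStarSeminorm p) (S : NonUnitalStarSubalgebra ℂ A)
    {x : A} (hx : x ∈ S) {ε : ℝ} (hε : 0 < ε) :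
    ∃ v ∈ S, star v = v ∧ p v ≤ 1 ∧ (∀ y, p (y - v * y) ≤ p y) ∧ p (x - x * v) < ε := by
  obtain ⟨E, _, φ, hadd, hsub, hmul, hstar, hnorm⟩ := exists_isometric_cStarAlgebra hp
  -- Rescale `x` into the unit ball, where the polynomial estimates hold; the `+ 1` covers `p x =
  -- 0`.
  obtain ⟨c, hc0, hc⟩ : ∃ c : ℝ, 0 < c ∧ c * p x ≤ 1 :=
    ⟨(p x + 1)⁻¹, by positivity, by
      rw [inv_mul_le_iff₀ (by positivity)]; linarith⟩
  set z : A := (c : ℂ) • x with hz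
  have hpz : p z = c * p x := by
    rw [hz, map_smul_eq_mul, Complex.norm_real, Real.norm_eq_abs, abs_of_pos hc0]
  have hzS : z ∈ S := S.smul_mem _ hx
  -- Since `n · (c · p (x - x w))² ≤ 1`, any `n > (c ε)⁻²` forces `p (x - x w) < ε`.
  obtain ⟨n, hn⟩ := exists_nat_gt ((c * ε)⁻¹ ^ 2)
  have hφ0 : φ 0 = 0 := by simpa using hsub 0 0
  have hφw : ∀ m, φ (oneSubPow (star z * z) m) = oneSubPow (star (φ z) * φ z) m := fun m => by
    induction m with
    | zero => simp [oneSubPow, hφ0]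
    | succ m ih => simp only [oneSubPow, hsub, hadd, hmul, hstar, ih]
  obtain ⟨h1, h2, h3⟩ := norm_oneSubPow_estimates (φ z) (by rw [hnorm, hpz]; exact hc) n
  simp only [← hφw, ← hmul, ← hsub, hnorm] at h1 h3
  refine ⟨oneSubPow (star z * z) n, ?_, (star_oneSubPow (by simp) n).1, h1, fun y => ?_, ?_⟩
  · have hb : star z * z ∈ S := S.mul_mem (S.star_mem' hzS) hzS
    clear * - hb
    induction n with
    | zero => exact S.zero_mem
    | succ n ih => exact S.sub_mem (S.add_mem ih hb) (S.mul_mem hb ih)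
  · have := h2 (φ y)
    rwa [← hφw, ← hmul, ← hsub, hnorm, hnorm] at this
  · set w := oneSubPow (star z * z) n
    have hzw : p (z - z * w) = c * p (x - x * w) := by
      rw [hz, smul_mul_assoc, ← smul_sub, map_smul_eq_mul, Complex.norm_real, Real.norm_eq_abs,
        abs_of_pos hc0]
    rw [hzw] at h3
    by_contra! hcon
    have h4 : (c * ε) ^ 2 ≤ (c * p (x - x * w)) ^ 2 := by gcongr
    have h5 : 0 < (c * ε) ^ 2 := by positivity
    rw [inv_pow, inv_lt_iff_one_lt_mul₀ h5] at hn
    nlinarith [Nat.cast_nonneg (α := ℝ) n]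

end ApproximateUnit

/-! ### Cauchy–Schwarz for positive functionals -/

section CauchySchwarz

variable {A : Type*} [NonUnitalRing A] [StarRing A] [Module ℂ A]
  [IsScalarTower ℂ A A] [SMulCommClass ℂ A A] [StarModule ℂ A]

/-- Polarization: `f` is real on the squares of `a + b` and `a + i b`, which gives the imaginary and
real parts of the identity. -/
theorem conj_map_star_mul {f : A →ₗ[ℂ] ℂ} (hf : ∀ a, 0 ≤ f (star a * a)) (a b : A) :
    (starRingEnd ℂ) (f (star b * a)) = f (star a * b) := by
  have him : ∀ a, (f (star a * a)).im = 0 := fun a => (Complex.nonneg_iff.1 (hf a)).2.symm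
  have h1 := him (a + b)
  have h2 := him (a + Complex.I • b)
  simp only [star_add, star_smul, add_mul, mul_add, smul_mul_assoc, mul_smul_comm, map_add,
    map_smul, smul_eq_mul, Complex.add_im, Complex.mul_im, Complex.mul_re, him, Complex.star_def,
    Complex.conj_I, Complex.neg_re, Complex.neg_im, Complex.I_re, Complex.I_im] at h1 h2
  apply Complex.ext <;> simp <;> linarith

theorem norm_map_star_mul_sq_le {f : A →ₗ[ℂ] ℂ} (hf : ∀ a, 0 ≤ f (star a * a)) (a b : A) :
    ‖f (star a * b)‖ ^ 2 ≤ (f (star a * a)).re * (f (star b * b)).re := by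
  let core : PreInnerProductSpace.Core ℂ A :=
    { inner := fun x y => f (star x * y)
      conj_inner_symm := fun x y => conj_map_star_mul hf x y
      re_inner_nonneg := fun x => (Complex.nonneg_iff.1 (hf x)).1
      add_left := fun x y z => by simp [star_add, add_mul]
      smul_left := fun x y r => by simp [smul_mul_assoc] }
  have h := InnerProductSpace.Core.inner_mul_inner_self_le (𝕜 := ℂ) (c := core) a b
  have h' : ‖f (star a * b)‖ * ‖f (star b * a)‖ ≤ (f (star a * a)).re * (f (star b * b)).re := h
  rwa [← conj_map_star_mul hf b a, RCLike.norm_conj, ← sq] at h'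

theorem norm_map_star_mul_le {f : A →ₗ[ℂ] ℂ} (hf : ∀ a, 0 ≤ f (star a * a)) (a b : A) :
    ‖f (star a * b)‖ ≤ √((f (star a * a)).re * (f (star b * b)).re) :=
  Real.le_sqrt_of_sq_le (norm_map_star_mul_sq_le hf a b)

end CauchySchwarz

/-! ### `C*`-seminorms and continuity bounds -/

section CStarSeminorm

variable {A : Type*} [NonUnitalRing A] [StarRing A] [Module ℂ A] {p q : Seminorm ℂ A}

theorem IsCStarSeminorm.sup (hp : IsCStarSeminorm p) (hq : IsCStarSeminorm q) :
    IsCStarSeminorm (p ⊔ q) where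
  mul_le a b := by
    simp only [Seminorm.sup_apply]
    refine max_le ((hp.mul_le a b).trans ?_) ((hq.mul_le a b).trans ?_)
    · exact mul_le_mul (le_max_left _ _) (le_max_left _ _) (apply_nonneg _ _)
        ((apply_nonneg p a).trans (le_max_left _ _))
    · exact mul_le_mul (le_max_right _ _) (le_max_right _ _) (apply_nonneg _ _)
        ((apply_nonneg p a).trans (le_max_left _ _))
  star_mul_self a := by
    simp only [Seminorm.sup_apply, hp.star_mul_self, hq.star_mul_self]
    exact ((pow_left_monotoneOn (n := 2)).map_max (apply_nonneg p a) (apply_nonneg q a)).symm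

theorem isCStarSeminorm_finset_sup {ι : Type*} {p : ι → Seminorm ℂ A}
    (hp : ∀ i, IsCStarSeminorm (p i)) (s : Finset ι) : IsCStarSeminorm (s.sup p) := by
  classical
  induction s using Finset.induction_on with
  | empty =>
    rw [Finset.sup_empty, Seminorm.bot_eq_zero]
    exact ⟨fun a b => by simp, fun a => by simp⟩
  | insert i s _ ih => rw [Finset.sup_insert]; exact (hp i).sup ih

theorem continuous_finset_sup_seminorm [TopologicalSpace A] {ι : Type*} {p : ι → Seminorm ℂ A}
    (hp : ∀ i, Continuous (p i)) (s : Finset ι) : Continuous ⇑(s.sup p) := by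
  classical
  induction s using Finset.induction_on with
  | empty => simpa using continuous_zero
  | insert i s _ ih =>
    rw [Finset.sup_insert, Seminorm.coe_sup]
    exact (hp i).sup ih

theorem exists_cStarSeminorm_bound [TopologicalSpace A] {ι : Type*} {p : ι → Seminorm ℂ A}
    (hw : WithSeminorms p) (f : A →L[ℂ] ℂ) :
    ∃ (s : Finset ι) (C : ℝ), 0 ≤ C ∧ ∀ a, ‖f a‖ ≤ C * s.sup p a := by
  obtain ⟨s, C, -, h⟩ := Seminorm.bound_of_continuous hw
    ((normSeminorm ℂ ℂ).comp f.toLinearMap) (continuous_norm.comp f.continuous)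
  exact ⟨s, C, C.2, fun a => h a⟩

theorem exists_bound_of_continuous [UniformSpace A] [hA : IsLocallyCStarAlgebra A]
    (f : A →L[ℂ] ℂ) : ∃ (p : Seminorm ℂ A) (C : ℝ), IsCStarSeminorm p ∧ Continuous p ∧ 0 ≤ C ∧
      ∀ a, ‖f a‖ ≤ C * p a := by
  obtain ⟨Γ, -, -, hΓ, hw⟩ := hA.exists_seminorms
  obtain ⟨s, C, hC, h⟩ := exists_cStarSeminorm_bound hw f
  exact ⟨_, C, isCStarSeminorm_finset_sup (fun p : Γ => hΓ p p.2) s,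
    continuous_finset_sup_seminorm hw.continuous_seminorm s, hC, h⟩

theorem continuous_of_norm_le_seminorm [TopologicalSpace A] [IsTopologicalAddGroup A]
    {f : A →ₗ[ℂ] ℂ} {C : ℝ} (hp : Continuous p) (h : ∀ a, ‖f a‖ ≤ C * p a) : Continuous f := by
  refine continuous_of_continuousAt_zero f ?_
  rw [ContinuousAt, map_zero]
  refine squeeze_zero_norm h ?_
  have : Filter.Tendsto (fun a => C * p a) (nhds 0) (nhds (C * p 0)) :=
    (continuous_const.mul hp).tendsto 0
  simpa using this

/-- Self-improvement of the constant: if `K` is the best constant, then `‖φ a‖² ≤ G ‖φ (a* a)‖ ≤ G K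
(p a)²`, so `K ≤ √(G K)` and hence `K ≤ G`. Linearity of `φ` plays no role. -/
theorem norm_le_of_norm_sq_le (hp : IsCStarSeminorm p) {φ : A → ℂ} {K G : ℝ} (hG : 0 ≤ G)
    (hK : ∀ a, ‖φ a‖ ≤ K * p a) (h : ∀ a, ‖φ a‖ ^ 2 ≤ G * ‖φ (star a * a)‖) (a : A) :
    ‖φ a‖ ≤ G * p a := by
  set T : Set ℝ := {K | 0 ≤ K ∧ ∀ a, ‖φ a‖ ≤ K * p a} with hT
  have hne : T.Nonempty := ⟨|K|, abs_nonneg _, fun a =>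
    (hK a).trans (mul_le_mul_of_nonneg_right (le_abs_self K) (apply_nonneg _ _))⟩
  have hbdd : BddBelow T := ⟨0, fun _ h => h.1⟩
  have hcl : IsClosed T := by
    rw [hT, Set.ofPred_and, Set.ofPred_forall]
    exact isClosed_Ici.inter (isClosed_iInter fun a => isClosed_le continuous_const (by fun_prop))
  obtain ⟨h0, h1⟩ := hcl.csInf_mem hne hbdd
  have h2 : √(G * sInf T) ∈ T := ⟨Real.sqrt_nonneg _, fun a => by
    refine abs_le_of_sq_le_sq' ?_ (by positivity) |>.2
    rw [mul_pow, Real.sq_sqrt (by positivity), ← hp.star_mul_self, mul_assoc]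
    exact (h a).trans (mul_le_mul_of_nonneg_left (h1 _) hG)⟩
  have h3 : sInf T ≤ √(G * sInf T) := csInf_le hbdd h2
  have h4 : sInf T ≤ G := by
    rcases h0.eq_or_lt with h0 | h0
    · rw [← h0]; exact hG
    · rw [Real.le_sqrt' h0, sq] at h3
      exact le_of_mul_le_mul_right h3 h0
  exact (h1 a).trans (mul_le_mul_of_nonneg_right h4 (apply_nonneg _ _))

end CStarSeminorm

/-! ### Bounds for positive functionals without a unit -/

section Functionals

variable {A : Type*} [NonUnitalRing A] [StarRing A] [Module ℂ A]
  [IsScalarTower ℂ A A] [SMulCommClass ℂ A A] [StarModule ℂ A] {p q : Seminorm ℂ A}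

/-- Cauchy–Schwarz gives `|f (x* b x)|² ≤ f (x* x) · f (x* b* b x)`, so the self-improving bound
applies to `b ↦ f (x* b x)` with `G = f (x* x)`. -/
theorem map_star_conj_le (hp : IsCStarSeminorm p) {f : A →ₗ[ℂ] ℂ} {C : ℝ}
    (hf : ∀ a, 0 ≤ f (star a * a)) (hC : 0 ≤ C) (hfp : ∀ a, ‖f a‖ ≤ C * p a) (a x : A) :
    (f (star (a * x) * (a * x))).re ≤ p a ^ 2 * (f (star x * x)).re := by
  have key := norm_le_of_norm_sq_le hp (φ := fun b => f (star x * (b * x)))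
    (K := C * p x ^ 2) (G := (f (star x * x)).re) (Complex.nonneg_iff.1 (hf x)).1
    (fun b => by
      have h1 := hp.mul_le (star x) (b * x)
      have h2 := hp.mul_le b x
      rw [hp.map_star] at h1
      have h3 := mul_le_mul_of_nonneg_left h2 (apply_nonneg p x)
      calc _ ≤ C * p (star x * (b * x)) := hfp _
        _ ≤ C * (p x * (p b * p x)) := mul_le_mul_of_nonneg_left (h1.trans h3) hC
        _ = _ := by ring)
    (fun b => by
      refine (norm_map_star_mul_sq_le hf x (b * x)).trans ?_
      refine mul_le_mul_of_nonneg_left ((Complex.re_le_norm _).trans ?_)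
        (Complex.nonneg_iff.1 (hf x)).1
      simp only [star_mul, mul_assoc]; exact le_rfl) (star a * a)
  rw [hp.star_mul_self, mul_comm] at key
  refine le_trans (le_trans (Complex.re_le_norm _) (le_of_eq ?_)) key
  simp only [star_mul, mul_assoc]

/-- For an approximate unit `v`, `|h (v x)|² ≤ h (v²) h (x* x) ≤ f (v²) h (x* x) ≤ C h (x* x)`. The
error `h (x - v x)` is controlled only by `q`, so `v` is chosen for `q`; yet the final constant
depends on `f` alone. -/
theorem norm_sq_le_of_le (hq : IsCStarSeminorm q) (hpq : p ≤ q) {f h : A →ₗ[ℂ] ℂ}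
    {C K : ℝ} (hC : 0 ≤ C) (hfp : ∀ a, ‖f a‖ ≤ C * p a) (hp : IsCStarSeminorm p)
    (hh : ∀ a, 0 ≤ h (star a * a)) (hK : 0 ≤ K) (hhq : ∀ a, ‖h a‖ ≤ K * q a)
    (hle : ∀ a, h (star a * a) ≤ f (star a * a)) (x : A) :
    ‖h x‖ ^ 2 ≤ C * (h (star x * x)).re := by
  have hx0 := (Complex.nonneg_iff.1 (hh x)).1
  have key : ‖h x‖ ≤ √(C * (h (star x * x)).re) := by
    refine le_of_forall_pos_le_add fun ε hε => ?_
    obtain ⟨v, -, hvs, hv1, -, hv⟩ := hq.exists_approximateUnit ⊤ (x := star x) trivial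
      (ε := ε / (K + 1)) (by positivity)
    have e : q (star x - star x * v) = q (x - v * x) := by
      rw [← hq.map_star (x - v * x), star_sub, star_mul, hvs]
    rw [e] at hv
    have h1 : ‖h (v * x)‖ ≤ √(C * (h (star x * x)).re) := by
      have h2 := norm_map_star_mul_le hh v x
      rw [hvs] at h2
      refine h2.trans (Real.sqrt_le_sqrt (mul_le_mul_of_nonneg_right ?_ hx0))
      calc (h (v * v)).re = (h (star v * v)).re := by rw [hvs]
        _ ≤ (f (star v * v)).re := (Complex.le_def.1 (hle v)).1
        _ ≤ ‖f (star v * v)‖ := Complex.re_le_norm _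
        _ ≤ C * p (star v * v) := hfp _
        _ ≤ C * 1 := by
          rw [hp.star_mul_self]
          exact mul_le_mul_of_nonneg_left (pow_le_one₀ (apply_nonneg _ _) ((hpq v).trans hv1)) hC
        _ = C := mul_one C
    have h3 : ‖h (x - v * x)‖ ≤ ε := by
      refine (hhq _).trans ?_
      rw [lt_div_iff₀ (by positivity)] at hv
      nlinarith [apply_nonneg q (x - v * x)]
    calc ‖h x‖ = ‖h (v * x) + h (x - v * x)‖ := by rw [← map_add, add_sub_cancel]
      _ ≤ _ := (norm_add_le _ _).trans (add_le_add h1 h3)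
  rwa [Real.le_sqrt (norm_nonneg _) (by positivity)] at key

end Functionals

/-! ### Domination and summation of positive functionals -/

section LocallyCStarAlgebra

variable {A : Type*} [NonUnitalRing A] [StarRing A] [Module ℂ A] [UniformSpace A]
  [IsLocallyCStarAlgebra A]

/-- The bound on a positive functional also holds for the functionals it dominates. -/
theorem IsPositiveFunctional.norm_sq_le_of_le {p : Seminorm ℂ A} (hp : IsCStarSeminorm p)
    {f h : A →L[ℂ] ℂ} {C : ℝ} (hC : 0 ≤ C) (hfp : ∀ a, ‖f a‖ ≤ C * p a)
    (hh : IsPositiveFunctional h) (hle : ∀ a, h (star a * a) ≤ f (star a * a)) (x : A) :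
    ‖h x‖ ^ 2 ≤ C * (h (star x * x)).re := by
  obtain ⟨q, K, hq, -, hK, hhq⟩ := exists_bound_of_continuous h
  exact _root_.norm_sq_le_of_le (f := f.toLinearMap) (h := h.toLinearMap) (hp.sup hq) le_sup_left
    hC hfp hp hh hK
    (fun a => (hhq a).trans (mul_le_mul_of_nonneg_left (le_max_right _ _) hK)) hle x

/-- Everything below `f` is controlled by the same seminorm and constant as `f`, although each `h`
is a priori continuous for its own seminorm. This uniformity makes limits of such functionals
continuous. -/
theorem IsPositiveFunctional.norm_le_of_le {p : Seminorm ℂ A} (hp : IsCStarSeminorm p)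
    {f h : A →L[ℂ] ℂ} {C : ℝ} (hC : 0 ≤ C) (hfp : ∀ a, ‖f a‖ ≤ C * p a)
    (hh : IsPositiveFunctional h) (hle : ∀ a, h (star a * a) ≤ f (star a * a)) (x : A) :
    ‖h x‖ ≤ C * p x := by
  refine abs_le_of_sq_le_sq' ?_ (mul_nonneg hC (apply_nonneg _ _)) |>.2
  calc ‖h x‖ ^ 2 ≤ C * (h (star x * x)).re := hh.norm_sq_le_of_le hp hC hfp hle x
    _ ≤ C * (C * p (star x * x)) := mul_le_mul_of_nonneg_left
      ((Complex.le_def.1 (hle x)).1.trans ((Complex.re_le_norm _).trans (hfp _))) hC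
    _ = (C * p x) ^ 2 := by rw [hp.star_mul_self]; ring

theorem IsPositiveFunctional.exists_norm_sq_le {f : A →L[ℂ] ℂ} (hf : IsPositiveFunctional f) :
    ∃ C : ℝ, 0 ≤ C ∧ ∀ x, ‖f x‖ ^ 2 ≤ C * (f (star x * x)).re := by
  obtain ⟨p, C, hp, -, hC, h⟩ := exists_bound_of_continuous f
  exact ⟨C, hC, hf.norm_sq_le_of_le hp hC h fun _ => le_rfl⟩

theorem IsPositiveFunctional.map_eq_zero {f : A →L[ℂ] ℂ} (hf : IsPositiveFunctional f) {x : A}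
    (h : f (star x * x) ≤ 0) : f x = 0 := by
  obtain ⟨C, hC, hb⟩ := hf.exists_norm_sq_le
  have h1 := hb x
  have h2 : (f (star x * x)).re ≤ 0 := (Complex.le_def.1 h).1
  have h3 : ‖f x‖ ^ 2 ≤ 0 := h1.trans (mul_nonpos_of_nonneg_of_nonpos hC h2)
  simpa using le_antisymm h3 (sq_nonneg _)

theorem isPositiveFunctional_sum {ι : Type*} {f : ι → A →L[ℂ] ℂ}
    (hf : ∀ i, IsPositiveFunctional (f i)) (s : Finset ι) :
    IsPositiveFunctional (∑ i ∈ s, f i) := fun a => by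
  rw [sum_apply]
  exact Finset.sum_nonneg fun i _ => hf i a

/-- A family of positive functionals with bounded finite partial sums is summable. -/
theorem exists_hasSum_of_sum_le {ι : Type*} {f : ι → A →L[ℂ] ℂ} {F : A →L[ℂ] ℂ}
    (hf : ∀ i, IsPositiveFunctional (f i))
    (hle : ∀ (s : Finset ι) (a : A), ∑ i ∈ s, f i (star a * a) ≤ F (star a * a)) :
    ∃ G : A →L[ℂ] ℂ, (∀ a, G (star a * a) ≤ F (star a * a)) ∧
      ∀ a, HasSum (fun i => f i a) (G a) := by
  obtain ⟨p, C, hp, hpc, hC, hb⟩ := exists_bound_of_continuous F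
  have hle' : ∀ (s : Finset ι) (a : A), (∑ i ∈ s, f i) (star a * a) ≤ F (star a * a) :=
    fun s a => by rw [sum_apply]; exact hle s a
  have hsum : ∀ a, Summable fun i => f i a := fun a => by
    have h1 : Summable fun i => (f i (star a * a)).re :=
      summable_of_sum_le (fun i => (Complex.nonneg_iff.1 (hf i a)).1) fun s => by
        rw [← Complex.re_sum]; exact (Complex.le_def.1 (hle s a)).1
    rw [summable_iff_vanishing_norm] at h1 ⊢
    intro ε hε
    -- A finite block of the series is itself a positive functional below `F`, so its squared value
    -- at `a` is at most `C` times its value at `a* a`, which is small far out.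
    obtain ⟨s, hs⟩ := h1 (ε ^ 2 / (C + 1)) (by positivity)
    refine ⟨s, fun t ht => ?_⟩
    have h2 := (isPositiveFunctional_sum hf t).norm_sq_le_of_le hp hC hb (hle' t) a
    rw [sum_apply, sum_apply, Complex.re_sum] at h2
    have h3 := (le_abs_self _).trans_lt (hs t ht)
    rw [lt_div_iff₀ (by positivity)] at h3
    have h4 : 0 ≤ ∑ i ∈ t, (f i (star a * a)).re :=
      Finset.sum_nonneg fun i _ => (Complex.nonneg_iff.1 (hf i a)).1
    exact lt_of_pow_lt_pow_left₀ 2 hε.le (by nlinarith)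
  let G : A →ₗ[ℂ] ℂ :=
    { toFun := fun a => ∑' i, f i a
      map_add' := fun a b => by simp only [map_add]; exact (hsum a).tsum_add (hsum b)
      map_smul' := fun c a => by
        simp only [map_smul, smul_eq_mul, RingHom.id_apply]; exact tsum_mul_left }
  have hG : ∀ a, HasSum (fun i => f i a) (G a) := fun a => (hsum a).hasSum
  have hGb : ∀ a, ‖G a‖ ≤ C * p a := fun a =>
    le_of_tendsto (hG a).norm (Filter.Eventually.of_forall fun s => by
      have := (isPositiveFunctional_sum hf s).norm_le_of_le hp hC hb (hle' s) a
      rwa [sum_apply] at this)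
  exact ⟨⟨G, continuous_of_norm_le_seminorm hpc hGb⟩,
    fun a => le_of_tendsto (hG _) (Filter.Eventually.of_forall fun s => hle s a), hG⟩

end LocallyCStarAlgebra

/-! ### Closed ideals as locally `C*`-algebras -/

section Constructors

variable {A : Type*} [NonUnitalRing A] [StarRing A] [Module ℂ A]

theorem WithSeminorms.range {E ι : Type*} [AddCommGroup E] [Module ℂ E] [TopologicalSpace E]
    {p : ι → Seminorm ℂ E} (hp : WithSeminorms p) :
    WithSeminorms (fun q : Set.range p => (q : Seminorm ℂ E)) := by
  have := hp.topologicalAddGroup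
  rw [SeminormFamily.withSeminorms_iff_nhds_eq_iInf] at hp ⊢
  rw [hp, iInf_range' (fun q : Seminorm ℂ E => Filter.comap q (nhds 0))]

theorem IsLocallyCStarAlgebra.of_directed [UniformSpace A] [IsTopologicalStarAlgebra A]
    [CompleteSpace A] [T2Space A] {ι : Type*} [Nonempty ι] {p : ι → Seminorm ℂ A}
    (hp : ∀ i, IsCStarSeminorm (p i)) (hd : Directed (· ≤ ·) p) (hw : WithSeminorms p) :
    IsLocallyCStarAlgebra A where
  exists_seminorms := ⟨Set.range p, Set.range_nonempty p, hd.directedOn_range,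
    by rintro _ ⟨i, rfl⟩; exact hp i, hw.range⟩

end Constructors

namespace ClosedStarIdeal

variable {A : Type*} [NonUnitalRing A] [StarRing A] [Module ℂ A] [UniformSpace A]

/-- The inclusion of the ideal. -/
def incl (I : ClosedStarIdeal A) : I.toNonUnitalStarSubalgebra →ₗ[ℂ] A :=
  I.toSubspace.subtype

section

variable [IsTopologicalStarAlgebra A] (I : ClosedStarIdeal A)

instance : IsTopologicalStarAlgebra I.toNonUnitalStarSubalgebra where
  smul_assoc c x y := Subtype.ext (smul_mul_assoc c (x : A) (y : A))
  smul_comm c x y := Subtype.ext (mul_smul_comm c (x : A) (y : A)).symm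
  star_smul c x := Subtype.ext (star_smul c (x : A))
  uniformContinuous_sub :=
    (inferInstance : IsUniformAddGroup I.toSubspace.toAddSubgroup).uniformContinuous_sub
  continuous_smul := (inferInstance : ContinuousSMul ℂ I.toSubspace).continuous_smul
  continuous_mul := Continuous.subtype_mk
    ((continuous_subtype_val.comp continuous_fst).mul (continuous_subtype_val.comp continuous_snd)) _
  continuous_star := Continuous.subtype_mk (continuous_star.comp continuous_subtype_val) _

end

theorem isCStarSeminorm_comp_incl (I : ClosedStarIdeal A) {p : Seminorm ℂ A}
    (hp : IsCStarSeminorm p) : IsCStarSeminorm (p.comp I.incl) where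
  mul_le x y := hp.mul_le (x : A) (y : A)
  star_mul_self x := hp.star_mul_self (x : A)

theorem withSeminorms_comp_incl (I : ClosedStarIdeal A) {ι : Type*} {p : ι → Seminorm ℂ A}
    (hp : WithSeminorms p) : WithSeminorms (fun i => (p i).comp I.incl) :=
  I.incl.withSeminorms_induced hp

variable [hA : IsLocallyCStarAlgebra A] (I : ClosedStarIdeal A)

instance : IsLocallyCStarAlgebra I.toNonUnitalStarSubalgebra := by
  obtain ⟨Γ, hne, hd, hΓ, hw⟩ := hA.exists_seminorms
  have : CompleteSpace I.toNonUnitalStarSubalgebra := I.isClosed.completeSpace_coe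
  have : T2Space I.toNonUnitalStarSubalgebra := inferInstanceAs (T2Space I.carrier)
  have : Nonempty Γ := hne.to_subtype
  refine IsLocallyCStarAlgebra.of_directed (p := fun p : Γ => (p : Seminorm ℂ A).comp I.incl)
    (fun p => I.isCStarSeminorm_comp_incl (hΓ p p.2)) (fun p q => ?_)
    (I.withSeminorms_comp_incl hw)
  obtain ⟨r, hr, hpr, hqr⟩ := hd p p.2 q q.2
  exact ⟨⟨r, hr⟩, fun x => hpr x, fun x => hqr x⟩

theorem exists_bound (g : I.toNonUnitalStarSubalgebra →L[ℂ] ℂ) :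
    ∃ (p : Seminorm ℂ A) (C : ℝ), IsCStarSeminorm p ∧ Continuous p ∧ 0 ≤ C ∧
      ∀ x : I.toNonUnitalStarSubalgebra, ‖g x‖ ≤ C * p (x : A) := by
  obtain ⟨Γ, -, -, hΓ, hw⟩ := hA.exists_seminorms
  obtain ⟨s, C, hC, h⟩ := exists_cStarSeminorm_bound (I.withSeminorms_comp_incl hw) g
  refine ⟨_, C, isCStarSeminorm_finset_sup (fun p : Γ => hΓ p p.2) s,
    continuous_finset_sup_seminorm hw.continuous_seminorm s, hC, fun x => (h x).trans_eq ?_⟩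
  congr 1
  exact DFunLike.congr_fun
    (SeminormFamily.finset_sup_comp (fun p : Γ => (p : Seminorm ℂ A)) s I.incl).symm x

/-- Multiplication of elements of the ideal by elements of the algebra from the left. -/
def lmul (a : A) (x : I.toNonUnitalStarSubalgebra) : I.toNonUnitalStarSubalgebra :=
  ⟨a * x, I.mul_mem_left a x.2⟩

/-- Multiplication of elements of the ideal by elements of the algebra from the right. -/
def rmul (x : I.toNonUnitalStarSubalgebra) (a : A) : I.toNonUnitalStarSubalgebra :=
  ⟨x * a, I.mul_mem_right a x.2⟩

end ClosedStarIdeal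

/-! ### Almost units for a positive functional -/

section Functionals

variable {E : Type*} [NonUnitalRing E] [StarRing E] [Module ℂ E]
  [IsScalarTower ℂ E E] [SMulCommClass ℂ E E] [StarModule ℂ E]

/-- Elements that act almost as a unit for a positive functional. -/
theorem exists_almost_unit {f : E →ₗ[ℂ] ℂ} (hf : ∀ a, 0 ≤ f (star a * a)) {C : ℝ}
    (hC : 0 ≤ C) (hb : ∀ x, ‖f x‖ ^ 2 ≤ C * (f (star x * x)).re) {ε : ℝ} (hε : 0 < ε) :
    ∃ y, ∀ z, ‖f (star y * z) - f z‖ ^ 2 ≤ ε * (f (star z * z)).re := by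
  have hpos : ∀ a, 0 ≤ (f (star a * a)).re := fun a => (Complex.nonneg_iff.1 (hf a)).1
  -- If `f z = ⟨ξ, z⟩` for the form `⟨y, z⟩ = f (y* z)`, then `Q y = ‖y - ξ‖² - ‖ξ‖²`: a
  -- near-minimiser of `Q` approximates `ξ`.
  set Q : E → ℝ := fun y => (f (star y * y)).re - 2 * (f y).re with hQ
  have hbdd : BddBelow (Set.range Q) := by
    refine ⟨-C, ?_⟩
    rintro _ ⟨y, rfl⟩
    have h1 : 2 * ‖f y‖ ≤ C + (f (star y * y)).re := by
      refine abs_le_of_sq_le_sq' ?_ (add_nonneg hC (hpos y)) |>.2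
      nlinarith [hb y, sq_nonneg (C - (f (star y * y)).re)]
    have h2 := Complex.re_le_norm (f y)
    simp only [hQ]; linarith
  obtain ⟨_, ⟨y, rfl⟩, hy⟩ := exists_lt_of_csInf_lt (Set.range_nonempty Q)
    (lt_add_of_pos_right (sInf (Set.range Q)) hε)
  refine ⟨y, fun z => ?_⟩
  set c := f (star y * z) - f z with hc
  set G := (f (star z * z)).re with hG
  -- Perturb `y` to `y - s c̄ z`. Near-minimality makes a quadratic in `s` nonnegative, and its
  -- discriminant yields `‖c‖² ≤ ε G`.
  have hmin : ∀ s : ℝ, 0 ≤ ‖c‖ ^ 2 * G * (s * s) + (-2 * ‖c‖ ^ 2) * s + ε := fun s => by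
    set t : ℂ := -(s : ℂ) * (starRingEnd ℂ) c with ht
    have h1 : Q y ≤ Q (y + t • z) + ε :=
      hy.le.trans (by gcongr; exact csInf_le hbdd ⟨_, rfl⟩)
    have h2 : Q (y + t • z) = Q y + 2 * (t * c).re + ‖t‖ ^ 2 * G := by
      have h3 : f (star z * y) = (starRingEnd ℂ) (f (star y * z)) :=
        (conj_map_star_mul hf z y).symm
      simp only [hQ, star_add, star_smul, add_mul, mul_add, smul_mul_assoc, mul_smul_comm, map_add,
        map_smul, smul_eq_mul, h3, Complex.star_def, hc, hG, ← Complex.normSq_eq_norm_sq,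
        Complex.normSq_apply, Complex.add_re, Complex.mul_re, Complex.sub_re, Complex.sub_im,
        Complex.conj_re, Complex.conj_im, Complex.mul_im]
      ring
    have h4 : (t * c).re = -s * ‖c‖ ^ 2 := by
      have : t * c = ((-s * ‖c‖ ^ 2 : ℝ) : ℂ) := by
        rw [ht, mul_assoc, Complex.conj_mul']; push_cast; ring
      rw [this, Complex.ofReal_re]
    have h5 : ‖t‖ ^ 2 = s * s * ‖c‖ ^ 2 := by
      rw [ht, norm_mul, norm_neg, Complex.norm_real, RCLike.norm_conj, mul_pow, Real.norm_eq_abs,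
        sq_abs]; ring
    rw [h2, h4, h5] at h1
    linarith
  have hd := discrim_le_zero hmin
  rw [discrim] at hd
  rcases (sq_nonneg ‖c‖).eq_or_lt with h | h
  · rw [← h]; exact mul_nonneg hε.le (hpos z)
  · have : ‖c‖ ^ 2 * ‖c‖ ^ 2 ≤ ‖c‖ ^ 2 * (ε * G) := by nlinarith
    exact le_of_mul_le_mul_left this h

/-- Without a unit, use `f (x* v) = conj (f (v x))` for a selfadjoint approximate unit `v` and let
`v` improve. -/
theorem map_star_eq_conj {p : Seminorm ℂ E} (hp : IsCStarSeminorm p) {f : E →ₗ[ℂ] ℂ}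
    (hf : ∀ a, 0 ≤ f (star a * a)) {C : ℝ} (hC : 0 ≤ C) (hfp : ∀ a, ‖f a‖ ≤ C * p a) (x : E) :
    f (star x) = (starRingEnd ℂ) (f x) := by
  rw [← sub_eq_zero, ← norm_le_zero_iff]
  refine le_of_forall_pos_le_add fun ε hε => ?_
  obtain ⟨v, -, hvs, -, -, hv⟩ := hp.exists_approximateUnit ⊤ (x := star x) trivial
    (ε := ε / (2 * C + 1)) (by positivity)
  have e : p (star x - star x * v) = p (x - v * x) := by
    rw [← hp.map_star (x - v * x), star_sub, star_mul, hvs]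
  have h1 : f (star x * v) = (starRingEnd ℂ) (f (v * x)) := by
    rw [← conj_map_star_mul hf x v, hvs]
  have h2 : f (star x) - (starRingEnd ℂ) (f x) =
      f (star x - star x * v) - (starRingEnd ℂ) (f (x - v * x)) := by
    simp only [map_sub, h1]; ring
  have h3 := hfp (star x - star x * v)
  have h4 := hfp (x - v * x)
  rw [← e] at h4
  rw [lt_div_iff₀ (by positivity)] at hv
  rw [h2, zero_add]
  refine (norm_sub_le _ _).trans ?_
  rw [RCLike.norm_conj]
  nlinarith [apply_nonneg p (star x - star x * v)]

end Functionals

/-! ### The smallest positive extension from an ideal -/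

namespace ClosedStarIdeal

variable {A : Type*} [NonUnitalRing A] [StarRing A] [Module ℂ A] [UniformSpace A]
  [hA : IsLocallyCStarAlgebra A] (I : ClosedStarIdeal A)

/-- The self-improving bound again, now for `b ↦ g (y* b y)` with `b` ranging over all of `A`; it
bounds the approximants of the extension. -/
theorem norm_conj_le {g : I.toNonUnitalStarSubalgebra →L[ℂ] ℂ} (hg : IsPositiveFunctional g)
    {p : Seminorm ℂ A} (hp : IsCStarSeminorm p) {C : ℝ} (hC : 0 ≤ C)
    (hgp : ∀ x : I.toNonUnitalStarSubalgebra, ‖g x‖ ≤ C * p (x : A))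
    (y : I.toNonUnitalStarSubalgebra) (a : A) :
    ‖g (star y * I.lmul a y)‖ ≤ (g (star y * y)).re * p a := by
  refine norm_le_of_norm_sq_le hp (φ := fun b => g (star y * I.lmul b y))
    (K := C * p (y : A) ^ 2) (Complex.nonneg_iff.1 (hg y)).1 (fun b => ?_) (fun b => ?_) a
  · have h1 := hp.mul_le (star (y : A)) (b * y)
    have h2 := hp.mul_le b (y : A)
    rw [hp.map_star] at h1
    have h3 := mul_le_mul_of_nonneg_left h2 (apply_nonneg p (y : A))
    calc _ ≤ C * p (star (y : A) * (b * y)) := hgp _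
      _ ≤ C * (p (y : A) * (p b * p (y : A))) := mul_le_mul_of_nonneg_left (h1.trans h3) hC
      _ = _ := by ring
  · refine (norm_map_star_mul_sq_le (f := g.toLinearMap) hg y (I.lmul b y)).trans ?_
    refine mul_le_mul_of_nonneg_left ((Complex.re_le_norm _).trans ?_)
      (Complex.nonneg_iff.1 (hg y)).1
    have : star (I.lmul b y) * I.lmul b y = star y * I.lmul (star b * b) y :=
      Subtype.ext (by simp [lmul, star_mul, mul_assoc])
    rw [this]; exact le_rfl

/-- A Cauchy–Schwarz inequality between a functional on an ideal and a functional on the algebra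
that dominates it. -/
theorem norm_mul_sq_le {g : I.toNonUnitalStarSubalgebra →L[ℂ] ℂ} (hg : IsPositiveFunctional g)
    {f : A →L[ℂ] ℂ} (hf : IsPositiveFunctional f)
    (hle : ∀ x : I.toNonUnitalStarSubalgebra, g (star x * x) ≤ f (star (x : A) * x))
    (z : I.toNonUnitalStarSubalgebra) (a : A) :
    ‖g (I.rmul (star z) a)‖ ≤ √((g (star z * z)).re * (f (star a * a)).re) := by
  obtain ⟨p, C, hp, -, hC, hgp⟩ := I.exists_bound g
  obtain ⟨q, K, hq, -, hK, hfq⟩ := exists_bound_of_continuous f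
  have hr := hp.sup hq
  set r := p ⊔ q with hrdef
  refine le_of_forall_pos_le_add fun ε hε => ?_
  -- As `v` lies in `I`, so does `v a`. Cauchy–Schwarz in `I` applies to `g (z* v a)`, and `g ((v
  -- a)* (v a)) ≤ f ((v a)* (v a)) ≤ f (a* a)`.
  obtain ⟨v, hvI, hvs, hv1, -, hv⟩ := hr.exists_approximateUnit I.toNonUnitalStarSubalgebra
    (x := star (z : A)) (star z).2 (ε := ε / (C * r a + 1)) (by positivity)
  set w : I.toNonUnitalStarSubalgebra := I.rmul ⟨v, hvI⟩ a with hw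
  have h1 : ‖g (star z * w)‖ ≤ √((g (star z * z)).re * (f (star a * a)).re) := by
    refine (norm_map_star_mul_le (f := g.toLinearMap) hg z w).trans (Real.sqrt_le_sqrt ?_)
    refine mul_le_mul_of_nonneg_left ?_ (Complex.nonneg_iff.1 (hg z)).1
    have h2 : (g (star w * w)).re ≤ (f (star (v * a) * (v * a))).re := (Complex.le_def.1 (hle w)).1
    have h3 := map_star_conj_le (f := f.toLinearMap) hr hf hK
      (fun b => (hfq b).trans (mul_le_mul_of_nonneg_left (le_max_right _ _) hK)) v a
    refine h2.trans (h3.trans (mul_le_of_le_one_left (Complex.nonneg_iff.1 (hf a)).1 ?_))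
    exact pow_le_one₀ (apply_nonneg _ _) hv1
  have h4 : ‖g (I.rmul (star z) a - star z * w)‖ ≤ ε := by
    refine (hgp _).trans ?_
    have e : ((I.rmul (star z) a - star z * w : I.toNonUnitalStarSubalgebra) : A) =
        (star (z : A) - star (z : A) * v) * a := by
      rw [sub_mul, mul_assoc]; rfl
    rw [e]
    have h5 : p ((star (z : A) - star (z : A) * v) * a) ≤ r (star (z : A) - star (z : A) * v) * r a :=
      (le_max_left _ _).trans (hr.mul_le _ _)
    rw [lt_div_iff₀ (by positivity)] at hv
    nlinarith [apply_nonneg r (star (z : A) - star (z : A) * v), mul_le_mul_of_nonneg_left h5 hC]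
  calc ‖g (I.rmul (star z) a)‖ = ‖g (star z * w) + g (I.rmul (star z) a - star z * w)‖ := by
        rw [← map_add, add_sub_cancel]
    _ ≤ _ := (norm_add_le _ _).trans (add_le_add h1 h4)

/-- Every positive functional on a closed ideal has a smallest positive extension. -/
theorem exists_extension {g : I.toNonUnitalStarSubalgebra →L[ℂ] ℂ} (hg : IsPositiveFunctional g) :
    ∃ F : A →L[ℂ] ℂ, IsPositiveFunctional F ∧
      (∀ x : I.toNonUnitalStarSubalgebra, F x = g x) ∧
      ∀ f : A →L[ℂ] ℂ, IsPositiveFunctional f →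
        (∀ x : I.toNonUnitalStarSubalgebra, g (star x * x) ≤ f (star (x : A) * x)) →
        ∀ a, F (star a * a) ≤ f (star a * a) := by
  obtain ⟨p, C, hp, hpc, hC, hgp⟩ := I.exists_bound g
  obtain ⟨D, hD, hb⟩ := hg.exists_norm_sq_le
  have hpos : ∀ x, 0 ≤ (g (star x * x)).re := fun x => (Complex.nonneg_iff.1 (hg x)).1
  choose y hy using fun m : ℕ => exists_almost_unit (f := g.toLinearMap) hg hD hb
    (ε := 1 / ((m : ℝ) + 1)) Nat.one_div_pos_of_nat
  replace hy : ∀ m z, ‖g (star (y m) * z) - g z‖ ^ 2 ≤ 1 / ((m : ℝ) + 1) * (g (star z * z)).re := hy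
  -- Testing the almost-unit property on `y m` itself gives `G ≤ (1 + √D) √G` for `G = g (y* y)`.
  obtain ⟨N, hN0, hN⟩ : ∃ N : ℝ, 0 ≤ N ∧ ∀ m, (g (star (y m) * y m)).re ≤ N := by
    refine ⟨(1 + √D) ^ 2, sq_nonneg _, fun m => ?_⟩
    set G := (g (star (y m) * y m)).re with hG
    have hG0 : 0 ≤ G := hpos _
    have h1 : ‖g (star (y m) * y m) - g (y m)‖ ≤ √G := by
      refine Real.le_sqrt_of_sq_le ((hy m (y m)).trans (mul_le_of_le_one_left hG0 ?_))
      rw [div_le_one (by positivity)]; linarith [Nat.cast_nonneg (α := ℝ) m]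
    have h2 : ‖g (y m)‖ ≤ √D * √G := by
      rw [← Real.sqrt_mul hD]; exact Real.le_sqrt_of_sq_le (hb _)
    have h3 : G ≤ √G + √D * √G := by
      calc G ≤ ‖g (star (y m) * y m)‖ := Complex.re_le_norm _
        _ = ‖(g (star (y m) * y m) - g (y m)) + g (y m)‖ := by rw [sub_add_cancel]
        _ ≤ _ := (norm_add_le _ _).trans (add_le_add h1 h2)
    have h4 : √G ≤ 1 + √D := by
      rcases (Real.sqrt_nonneg G).eq_or_lt with h | h
      · rw [← h]; positivity
      · refine le_of_mul_le_mul_right ?_ h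
        rw [Real.mul_self_sqrt hG0]; linarith
    calc G = √G ^ 2 := (Real.sq_sqrt hG0).symm
      _ ≤ _ := by gcongr
  set Φ : ℕ → A → ℂ := fun m a => g (star (y m) * I.lmul a (y m)) with hΦ
  have hΦb : ∀ m a, ‖Φ m a‖ ≤ N * p a := fun m a =>
    (I.norm_conj_le hg hp hC hgp (y m) a).trans
      (mul_le_mul_of_nonneg_right (hN m) (apply_nonneg _ _))
  -- Boundedness gives limits along one ultrafilter for all `a` at once, so convergence of the
  -- sequence itself need not be proved.
  let U : Ultrafilter ℕ := Filter.hyperfilter ℕ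
  have hlim : ∀ a, ∃ l : ℂ, Filter.Tendsto (fun m => Φ m a) U (nhds l) := fun a => by
    obtain ⟨l, -, hl⟩ := (isCompact_closedBall (0 : ℂ) (N * p a)).ultrafilter_le_nhds
      (U.map fun m => Φ m a) (Filter.le_principal_iff.2 (Filter.mem_map.2
        (Filter.univ_mem' fun m => by simpa using hΦb m a)))
    exact ⟨l, hl⟩
  choose L hL using hlim
  have hzero : Filter.Tendsto (fun m : ℕ => √(1 / ((m : ℝ) + 1))) U (nhds 0) := by
    have := (tendsto_one_div_add_atTop_nhds_zero_nat (𝕜 := ℝ)).sqrt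
    rw [Real.sqrt_zero] at this
    exact this.mono_left (Nat.hyperfilter_le_atTop)
  -- The almost-unit property for `z = a y` lets the left factor `y*` be dropped from `g (y* a y)`
  -- in the limit.
  have hy' : ∀ (a : A) (m : ℕ), ‖g (star (y m) * I.lmul a (y m)) - g (I.lmul a (y m))‖ ≤
      √(1 / ((m : ℝ) + 1)) * (p a * √N) := fun a m => by
    have h1 : (g (star (I.lmul a (y m)) * I.lmul a (y m))).re ≤ p a ^ 2 * N := by
      have e : star (I.lmul a (y m)) * I.lmul a (y m) = star (y m) * I.lmul (star a * a) (y m) :=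
        Subtype.ext (by simp [lmul, star_mul, mul_assoc])
      rw [e]
      refine (Complex.re_le_norm _).trans ((hΦb m _).trans_eq ?_)
      rw [hp.star_mul_self, mul_comm]
    refine (Real.le_sqrt_of_sq_le (hy m _)).trans ?_
    rw [Real.sqrt_mul (by positivity)]
    refine mul_le_mul_of_nonneg_left ?_ (Real.sqrt_nonneg _)
    refine (Real.sqrt_le_sqrt h1).trans_eq ?_
    rw [Real.sqrt_mul (sq_nonneg _), Real.sqrt_sq (apply_nonneg _ _)]
  have hdiff : ∀ a : A, Filter.Tendsto
      (fun m => g (star (y m) * I.lmul a (y m)) - g (I.lmul a (y m))) U (nhds 0) := fun a =>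
    squeeze_zero_norm (hy' a) (by simpa using hzero.mul_const (p a * √N))
  let F₀ : A →ₗ[ℂ] ℂ :=
    { toFun := L
      map_add' := fun a b => tendsto_nhds_unique (hL (a + b)) (((hL a).add (hL b)).congr fun m => by
        simp only [hΦ]; rw [← map_add, ← mul_add]; congr 2
        exact Subtype.ext (add_mul a b (y m : A)).symm)
      map_smul' := fun c a => tendsto_nhds_unique (hL (c • a)) (((hL a).const_mul c).congr fun m => by
        simp only [hΦ]; rw [← smul_eq_mul, ← map_smul, ← mul_smul_comm]; congr 2
        exact Subtype.ext (smul_mul_assoc c a (y m : A)).symm) }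
  have hF₀ : ∀ a, ‖F₀ a‖ ≤ N * p a := fun a =>
    le_of_tendsto (hL a).norm (Filter.Eventually.of_forall fun m => hΦb m a)
  have hsq : ∀ (m : ℕ) (a : A), Φ m (star a * a) =
      g (star (I.lmul a (y m)) * I.lmul a (y m)) := fun m a => by
    simp only [hΦ]; congr 1
    exact Subtype.ext (by simp [lmul, star_mul, mul_assoc])
  have hstar : ∀ x, g (star x) = (starRingEnd ℂ) (g x) :=
    map_star_eq_conj (f := g.toLinearMap) (I.isCStarSeminorm_comp_incl hp) hg hC hgp
  refine ⟨⟨F₀, continuous_of_norm_le_seminorm hpc hF₀⟩, fun a => ?_, fun x => ?_,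
    fun f hf hle a => ?_⟩
  · refine ge_of_tendsto (hL (star a * a)) (Filter.Eventually.of_forall fun m => ?_)
    rw [hsq]; exact hg _
  · refine tendsto_nhds_unique (hL x) ?_
    have h1 : Filter.Tendsto (fun m => g (star (y m) * star x)) U (nhds (g (star x))) := by
      rw [tendsto_iff_norm_sub_tendsto_zero]
      refine squeeze_zero (fun _ => norm_nonneg _)
        (fun m => Real.le_sqrt_of_sq_le (hy m (star x))) ?_
      simp_rw [Real.sqrt_mul (Nat.one_div_pos_of_nat.le)]
      simpa using hzero.mul_const √(g (star (star x) * star x)).re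
    -- `g (x y)` is the conjugate of `g (y* x*)`, which tends to `g x*`.
    have h2 : Filter.Tendsto (fun m => g (I.lmul (x : A) (y m))) U (nhds (g x)) := by
      have h3 := (Complex.continuous_conj.tendsto _).comp h1
      rw [← hstar, star_star] at h3
      refine h3.congr fun m => ?_
      change (starRingEnd ℂ) (g (star (y m) * star x)) = _
      rw [← hstar, star_mul, star_star, star_star]; rfl
    have h4 := (hdiff (x : A)).add h2
    rw [zero_add] at h4
    exact h4.congr fun m => sub_add_cancel _ _
  · have hre : (L (star a * a)).re ≤ (f (star a * a)).re := by
      set R := (L (star a * a)).re with hR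
      have hLre : Filter.Tendsto (fun m => (g (star (I.lmul a (y m)) * I.lmul a (y m))).re) U
          (nhds R) := by
        refine ((Complex.continuous_re.tendsto _).comp (hL (star a * a))).congr fun m => ?_
        rw [Function.comp, hsq]
      -- Up to a vanishing error `g (y* a* a y)` is `g (a* a y)`, the conjugate of `g ((a y)* a)`.
      -- The mixed Cauchy–Schwarz inequality then gives in the limit `R ≤ √(R · f (a* a))`, hence `R
      -- ≤ f (a* a)`.
      have hbound : ∀ m, (g (star (I.lmul a (y m)) * I.lmul a (y m))).re ≤
          √(1 / ((m : ℝ) + 1)) * (p (star a * a) * √N) +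
          √((g (star (I.lmul a (y m)) * I.lmul a (y m))).re * (f (star a * a)).re) := fun m => by
        have h1 := I.norm_mul_sq_le hg hf hle (I.lmul a (y m)) a
        have h2 : g (I.rmul (star (I.lmul a (y m))) a) =
            (starRingEnd ℂ) (g (I.lmul (star a * a) (y m))) := by
          rw [← hstar]; congr 1
          exact Subtype.ext (by simp [lmul, rmul, star_mul, mul_assoc])
        rw [h2, RCLike.norm_conj] at h1
        rw [← hsq m a]
        calc (Φ m (star a * a)).re ≤ ‖Φ m (star a * a)‖ := Complex.re_le_norm _
          _ = ‖(Φ m (star a * a) - g (I.lmul (star a * a) (y m))) +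
              g (I.lmul (star a * a) (y m))‖ := by rw [sub_add_cancel]
          _ ≤ _ := (norm_add_le _ _).trans (add_le_add (hy' _ m) (by rwa [hsq]))
      have h3 : R ≤ √(R * (f (star a * a)).re) := by
        refine le_of_tendsto_of_tendsto' hLre ?_ hbound
        simpa using (hzero.mul_const (p (star a * a) * √N)).add
          (hLre.mul_const (f (star a * a)).re).sqrt
      rcases le_or_gt R 0 with h | h
      · exact h.trans (Complex.nonneg_iff.1 (hf a)).1
      · rw [Real.le_sqrt' h, sq] at h3
        exact le_of_mul_le_mul_left h3 h
    have him : (L (star a * a)).im = 0 := by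
      refine tendsto_nhds_unique ((Complex.continuous_im.tendsto _).comp (hL (star a * a)))
        (tendsto_const_nhds.congr fun m => ?_)
      rw [Function.comp, hsq]; exact (Complex.nonneg_iff.1 (hg _)).2
    exact Complex.le_def.2 ⟨hre, him.trans (Complex.nonneg_iff.1 (hf a)).2⟩

end ClosedStarIdeal

/-! ### Purity under extension and restriction -/

namespace ClosedStarIdeal

variable {A : Type*} [NonUnitalRing A] [StarRing A] [Module ℂ A] [UniformSpace A]
  [hA : IsLocallyCStarAlgebra A] (I : ClosedStarIdeal A)

/-- Restriction of a functional to the ideal. -/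
def restrict (f : A →L[ℂ] ℂ) : I.toNonUnitalStarSubalgebra →L[ℂ] ℂ :=
  f.comp ⟨I.incl, continuous_subtype_val⟩

theorem isPositiveFunctional_restrict {f : A →L[ℂ] ℂ} (hf : IsPositiveFunctional f) :
    IsPositiveFunctional (I.restrict f) := fun x => hf x

/-- If `h ≤ F`, purity gives `h = α g` on `I`, and minimality gives `α F ≤ h`. Then `k = h - α F` is
positive and zero on `I`, while `F - k` is positive and still extends `g`; minimality gives `F ≤ F -
k`, so `k = 0`. -/
theorem isPureFunctional_extension {g : I.toNonUnitalStarSubalgebra →L[ℂ] ℂ}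
    (hg : IsPureFunctional g) {F : A →L[ℂ] ℂ} (hF : IsPositiveFunctional F)
    (hFg : ∀ x : I.toNonUnitalStarSubalgebra, F x = g x)
    (hmin : ∀ f : A →L[ℂ] ℂ, IsPositiveFunctional f →
        (∀ x : I.toNonUnitalStarSubalgebra, g (star x * x) ≤ f (star (x : A) * x)) →
        ∀ a, F (star a * a) ≤ f (star a * a)) : IsPureFunctional F := by
  obtain ⟨hgpos, hg0, hgp⟩ := hg
  refine ⟨hF, fun h => hg0 ?_, fun h hh hle => ?_⟩
  · ext x; rw [← hFg, h]; rfl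
  obtain ⟨α, ⟨hα0, hα1⟩, hα⟩ := hgp (I.restrict h) (I.isPositiveFunctional_restrict hh)
    fun x => by rw [← hFg]; exact hle x
  refine ⟨α, ⟨hα0, hα1⟩, ?_⟩
  have h1 : ∀ a, (α : ℂ) * F (star a * a) ≤ h (star a * a) := fun a => by
    -- Minimality is applied to `α⁻¹ h`, so `α = 0` is separate.
    rcases hα0.eq_or_lt with h0 | h0
    · rw [← h0, Complex.ofReal_zero, zero_mul]; exact hh a
    have hαc : (0 : ℂ) ≤ ((α⁻¹ : ℝ) : ℂ) := Complex.zero_le_real.2 (inv_nonneg.2 hα0)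
    have hne : (α : ℂ) ≠ 0 := Complex.ofReal_ne_zero.2 h0.ne'
    have h2 := hmin (((α⁻¹ : ℝ) : ℂ) • h) (fun a => mul_nonneg hαc (hh a)) (fun x => by
      have h3 : h (star (x : A) * x) = (α : ℂ) * g (star x * x) := hα (star x * x)
      rw [smul_apply, h3, smul_eq_mul, Complex.ofReal_inv,
        inv_mul_cancel_left₀ hne]) a
    rw [smul_apply, smul_eq_mul, Complex.ofReal_inv] at h2
    have h4 := mul_le_mul_of_nonneg_left h2 (Complex.zero_le_real.2 hα0)
    rwa [mul_inv_cancel_left₀ hne] at h4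
  set k : A →L[ℂ] ℂ := h - (α : ℂ) • F with hk
  have hkapp : ∀ a, k a = h a - (α : ℂ) * F a := fun a => rfl
  have hkpos : IsPositiveFunctional k := fun a => sub_nonneg.2 (h1 a)
  have hkI : ∀ x : I.toNonUnitalStarSubalgebra, k x = 0 := fun x => by
    rw [hkapp, hFg]; exact sub_eq_zero.2 (hα x)
  have hFk : IsPositiveFunctional (F - k) := fun a => by
    rw [sub_apply, hkapp, sub_sub_eq_add_sub, add_sub_right_comm]
    exact add_nonneg (sub_nonneg.2 (hle a)) (mul_nonneg (Complex.zero_le_real.2 hα0) (hF a))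
  intro a
  have h5 := hmin (F - k) hFk (fun x => by
    have e := hkI (star x * x)
    have e' := hFg (star x * x)
    change k (star (x : A) * x) = 0 at e
    change F (star (x : A) * x) = _ at e'
    rw [sub_apply, e, e', sub_zero]) a
  rw [sub_apply, le_sub_self_iff] at h5
  exact sub_eq_zero.1 (hkpos.map_eq_zero h5)

/-- A functional below the restriction has a smallest extension, which lies below `f` and is
therefore a multiple of `f`. -/
theorem isPureFunctional_restrict {f : A →L[ℂ] ℂ} (hf : IsPureFunctional f)
    (h0 : I.restrict f ≠ 0) : IsPureFunctional (I.restrict f) := by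
  obtain ⟨hfpos, -, hfp⟩ := hf
  refine ⟨I.isPositiveFunctional_restrict hfpos, h0, fun h hh hle => ?_⟩
  obtain ⟨H, hH, hHh, hmin⟩ := I.exists_extension hh
  obtain ⟨α, hα, he⟩ := hfp H hH (hmin f hfpos hle)
  exact ⟨α, hα, fun x => by rw [← hHh, he]; rfl⟩

theorem isScattered_ideal (hs : IsScattered A) : IsScattered I.toNonUnitalStarSubalgebra := by
  intro g hg
  obtain ⟨F, hF, hFg, -⟩ := I.exists_extension hg
  obtain ⟨ι, _, f, hf, hsum⟩ := hs F hF
  -- Zero restrictions are not pure; dropping them leaves the sum unchanged.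
  refine ⟨{i // I.restrict (f i) ≠ 0}, inferInstance, fun i => I.restrict (f i),
    fun i => I.isPureFunctional_restrict (hf i) i.2, fun x => ?_⟩
  have h1 := hsum x
  rw [hFg] at h1
  refine (hasSum_subtype_iff_of_support_subset (f := fun i => I.restrict (f i) x)
    (s := {i | I.restrict (f i) ≠ 0}) fun i hi h => hi ?_).2 h1
  have h' : I.restrict (f i) = 0 := h
  simp [h']

end ClosedStarIdeal

/-! ### Scatteredness along a dense quotient map -/

theorem sum_le_of_hasSum {A ι : Type*} [NonUnitalRing A] [StarRing A] [Module ℂ A]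
    [TopologicalSpace A] {f : ι → A →L[ℂ] ℂ} (hf : ∀ i, IsPositiveFunctional (f i)) {F : A →L[ℂ] ℂ}
    (h : ∀ a, HasSum (fun i => f i a) (F a)) (s : Finset ι) (a : A) :
    ∑ i ∈ s, f i (star a * a) ≤ F (star a * a) :=
  sum_le_hasSum s (fun i _ => hf i a) (h _)

section Quotient

variable {A B : Type*} [NonUnitalRing A] [StarRing A] [Module ℂ A] [UniformSpace A]
  [NonUnitalRing B] [StarRing B] [Module ℂ B] [UniformSpace B]

/-- A continuous `*`-homomorphism with dense range through which all functionals vanishing on the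
ideal factor. -/
structure ClosedStarIdeal.IsDenseQuotientMap (I : ClosedStarIdeal A) (φ : A →L[ℂ] B) : Prop where
  map_star_mul : ∀ a, φ (star a * a) = star (φ a) * φ a
  denseRange : DenseRange φ
  map_mem : ∀ x ∈ I.toSubspace, φ x = 0
  exists_factor : ∀ f : A →L[ℂ] ℂ, (∀ x ∈ I.toSubspace, f x = 0) → ∃ k : B →L[ℂ] ℂ, k.comp φ = f

variable [hA : IsLocallyCStarAlgebra A] [hB : IsLocallyCStarAlgebra B] {I : ClosedStarIdeal A}
  {φ : A →L[ℂ] B}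

namespace ClosedStarIdeal.IsDenseQuotientMap

theorem le_of_comp_le (hφ : I.IsDenseQuotientMap φ) {h k : B →L[ℂ] ℂ}
    (hle : ∀ a, h.comp φ (star a * a) ≤ k.comp φ (star a * a)) (b : B) :
    h (star b * b) ≤ k (star b * b) := by
  refine hφ.denseRange.induction_on (p := fun b => h (star b * b) ≤ k (star b * b)) b
    (isClosed_le (by fun_prop) (by fun_prop)) fun a => ?_
  rw [← hφ.map_star_mul]; exact hle a

theorem eq_of_comp_eq (hφ : I.IsDenseQuotientMap φ) {h k : B →L[ℂ] ℂ}
    (he : ∀ a, h (φ a) = k (φ a)) : h = k := by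
  ext b
  exact hφ.denseRange.induction_on (p := fun b => h b = k b) b
    (isClosed_eq (by fun_prop) (by fun_prop)) he

theorem isPositive_iff (hφ : I.IsDenseQuotientMap φ) {k : B →L[ℂ] ℂ} :
    IsPositiveFunctional k ↔ IsPositiveFunctional (k.comp φ) := by
  refine ⟨fun h a => ?_, fun h b => ?_⟩
  · rw [ContinuousLinearMap.comp_apply, hφ.map_star_mul]; exact h _
  · simpa using hφ.le_of_comp_le (h := 0) (k := k) (fun a => by simpa using h a) b

theorem exists_factor_of_le (hφ : I.IsDenseQuotientMap φ) {k : B →L[ℂ] ℂ} {f : A →L[ℂ] ℂ}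
    (hf : IsPositiveFunctional f) (hle : ∀ a, f (star a * a) ≤ k.comp φ (star a * a)) :
    ∃ h : B →L[ℂ] ℂ, h.comp φ = f :=
  hφ.exists_factor f fun x hx => hf.map_eq_zero <| (hle x).trans_eq <| by
    rw [ContinuousLinearMap.comp_apply, hφ.map_star_mul, hφ.map_mem x hx, mul_zero, map_zero]

theorem isPure_iff (hφ : I.IsDenseQuotientMap φ) {k : B →L[ℂ] ℂ} :
    IsPureFunctional k ↔ IsPureFunctional (k.comp φ) := by
  have h0 : k ≠ 0 ↔ k.comp φ ≠ 0 := not_congr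
    ⟨fun h => by rw [h]; rfl, fun h => hφ.eq_of_comp_eq fun a => DFunLike.congr_fun h a⟩
  refine and_congr hφ.isPositive_iff (and_congr h0 ⟨fun h g hg hle => ?_, fun h g hg hle => ?_⟩)
  · obtain ⟨g, rfl⟩ := hφ.exists_factor_of_le hg hle
    obtain ⟨α, hα, he⟩ := h g (hφ.isPositive_iff.2 hg) (hφ.le_of_comp_le hle)
    exact ⟨α, hα, fun a => he _⟩
  · obtain ⟨α, hα, he⟩ := h (g.comp φ) (hφ.isPositive_iff.1 hg) fun a => by
      simp only [ContinuousLinearMap.comp_apply, hφ.map_star_mul]; exact hle _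
    refine ⟨α, hα, fun b => ?_⟩
    exact DFunLike.congr_fun (hφ.eq_of_comp_eq (h := g) (k := (α : ℂ) • k) he) b

theorem isScattered_quotient (hφ : I.IsDenseQuotientMap φ) (hs : IsScattered A) :
    IsScattered B := by
  intro k hk
  obtain ⟨ι, hι, f, hf, hsum⟩ := hs (k.comp φ) (hφ.isPositive_iff.1 hk)
  have hle := sum_le_of_hasSum (fun i => (hf i).1) hsum
  choose g hg using fun i => hφ.exists_factor_of_le (hf i).1 (fun a => by simpa using hle {i} a)
  have hgpure : ∀ i, IsPureFunctional (g i) := fun i => hφ.isPure_iff.2 (by rw [hg]; exact hf i)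
  -- Convergence is known only on the dense range of `φ`; domination by `k` gives it on all of `B`,
  -- and density identifies the sum with `k`.
  obtain ⟨G, -, hG⟩ := exists_hasSum_of_sum_le (F := k) (fun i => (hgpure i).1) fun s b => by
    rw [← sum_apply]
    refine hφ.le_of_comp_le (fun a => ?_) b
    have h1 := hle s a
    simp only [← hg] at h1
    simpa only [ContinuousLinearMap.comp_apply, sum_apply] using h1
  have : G = k := hφ.eq_of_comp_eq fun a => by
    refine (hG (φ a)).unique ?_
    have h1 := hsum a
    simp only [← hg] at h1
    exact h1
  exact ⟨ι, hι, g, hgpure, this ▸ hG⟩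

theorem isScattered_of_ideal_of_quotient (hφ : I.IsDenseQuotientMap φ)
    (hI : IsScattered I.toNonUnitalStarSubalgebra) (hQ : IsScattered B) : IsScattered A := by
  classical
  intro f hf
  obtain ⟨ι, hι, g, hg, hsum⟩ := hI (I.restrict f) (I.isPositiveFunctional_restrict hf)
  choose F hF hFg hmin using fun i => I.exists_extension (hg i).1
  have hFpure : ∀ i, IsPureFunctional (F i) := fun i =>
    I.isPureFunctional_extension (hg i) (hF i) (hFg i) (hmin i)
  have hle : ∀ (s : Finset ι) (a : A), ∑ i ∈ s, F i (star a * a) ≤ f (star a * a) := fun s => by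
    induction s using Finset.induction_on with
    | empty => intro a; simpa using hf a
    | insert i s hi ih =>
      intro a
      -- By induction `f - ∑ F j` is positive. On `I` it dominates `g i`, since the partial sums of
      -- the `g j` stay below `f`; so it dominates `F i` everywhere.
      have h1 := hmin i (f - ∑ j ∈ s, F j) (fun b => by
        rw [sub_apply, sum_apply]; exact sub_nonneg.2 (ih b)) (fun x => by
          have h2 := sum_le_of_hasSum (fun i => (hg i).1) hsum (insert i s) x
          rw [Finset.sum_insert hi] at h2
          rw [sub_apply, sum_apply, le_sub_iff_add_le]
          refine le_trans (le_of_eq ?_) h2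
          congr 1
          exact Finset.sum_congr rfl fun j _ => hFg j (star x * x)) a
      rw [sub_apply, sum_apply, le_sub_iff_add_le] at h1
      rwa [Finset.sum_insert hi]
  obtain ⟨G, hGle, hG⟩ := exists_hasSum_of_sum_le hF hle
  obtain ⟨k, hk⟩ := hφ.exists_factor (f - G) fun x hx => by
    have h1 := hG x
    have h2 := hsum ⟨x, hx⟩
    simp only [← hFg] at h2
    exact sub_eq_zero.2 (h2.unique h1)
  have hkpos : IsPositiveFunctional k := hφ.isPositive_iff.2 (by
    rw [hk]; exact fun a => sub_nonneg.2 (hGle a))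
  obtain ⟨κ, hκ, h, hh, hhsum⟩ := hQ k hkpos
  refine ⟨ι ⊕ κ, inferInstance, Sum.elim F fun j => (h j).comp φ, ?_, fun a => ?_⟩
  · rintro (i | j)
    · exact hFpure i
    · exact hφ.isPure_iff.1 (hh j)
  · have h1 : HasSum (fun j => h j (φ a)) (f a - G a) := by
      have := hhsum (φ a)
      rwa [← ContinuousLinearMap.comp_apply, hk] at this
    rw [← add_sub_cancel (G a) (f a)]
    exact HasSum.sum (f := fun i => Sum.elim F (fun j => (h j).comp φ) i a) (hG a) h1

theorem isScattered_iff (hφ : I.IsDenseQuotientMap φ) :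
    IsScattered A ↔ IsScattered I.toNonUnitalStarSubalgebra ∧ IsScattered B :=
  ⟨fun h => ⟨I.isScattered_ideal h, hφ.isScattered_quotient h⟩,
    fun h => hφ.isScattered_of_ideal_of_quotient h.1 h.2⟩

end ClosedStarIdeal.IsDenseQuotientMap

end Quotient

/-! ### Neighbourhoods of zero from directed seminorms -/

section DirectedSeminorms

variable {E ι : Type*} [AddCommGroup E] [Module ℂ E] [TopologicalSpace E] {p : ι → Seminorm ℂ E}

theorem WithSeminorms.exists_ball_subset [Nonempty ι] (hw : WithSeminorms p)
    (hd : Directed (· ≤ ·) p) {U : Set E} (hU : U ∈ nhds (0 : E)) :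
    ∃ i, ∃ r > 0, ∀ x, p i x < r → x ∈ U := by
  obtain ⟨⟨s, r⟩, hr, hs⟩ := hw.hasBasis_zero_ball.mem_iff.1 hU
  obtain ⟨i, hi⟩ := hd.finset_le s
  refine ⟨i, r, hr, fun x hx => hs ?_⟩
  rw [Seminorm.mem_ball_zero]
  exact lt_of_le_of_lt (Finset.sup_le (f := p) hi x) hx

theorem withSeminorms_of_exists_ball_subset [IsTopologicalAddGroup E]
    (hc : ∀ i, Continuous (p i))
    (h : ∀ U ∈ nhds (0 : E), ∃ i, ∃ r > 0, ∀ x, p i x < r → x ∈ U) : WithSeminorms p := by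
  rw [SeminormFamily.withSeminorms_iff_nhds_eq_iInf]
  refine le_antisymm (le_iInf fun i => ?_) fun U hU => ?_
  · rw [← Filter.tendsto_iff_comap]
    simpa using (hc i).tendsto 0
  · obtain ⟨i, r, hr, hsub⟩ := h U hU
    refine Filter.mem_iInf_of_mem i (Filter.mem_comap.2 ⟨Set.Iio r, Iio_mem_nhds hr, hsub⟩)

end DirectedSeminorms

/-! ### Quotient seminorms -/

namespace ClosedStarIdeal

variable {A : Type*} [NonUnitalRing A] [StarRing A] [Module ℂ A] [TopologicalSpace A]
  (I : ClosedStarIdeal A)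

theorem nonempty_fiber (y : I.Quotient) : Nonempty {a : A // I.proj a = y} :=
  let ⟨a, ha⟩ := I.proj_surjective y
  ⟨⟨a, ha⟩⟩

/-- The quotient seminorm as a function. -/
def quotientNorm (p : Seminorm ℂ A) (y : I.Quotient) : ℝ := ⨅ a : {a : A // I.proj a = y}, p a

theorem quotientNorm_le (p : Seminorm ℂ A) {a : A} {y : I.Quotient} (h : I.proj a = y) :
    I.quotientNorm p y ≤ p a :=
  ciInf_le (f := fun a : {a : A // I.proj a = y} => p a)
    ⟨0, by rintro _ ⟨a, rfl⟩; exact apply_nonneg p _⟩ ⟨a, h⟩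

theorem quotientNorm_nonneg (p : Seminorm ℂ A) (y : I.Quotient) : 0 ≤ I.quotientNorm p y :=
  Real.iInf_nonneg fun _ => apply_nonneg p _

theorem exists_lt_of_quotientNorm_lt {p : Seminorm ℂ A} {y : I.Quotient} {r : ℝ}
    (h : I.quotientNorm p y < r) : ∃ a, I.proj a = y ∧ p a < r :=
  have := I.nonempty_fiber y
  let ⟨a, ha⟩ := exists_lt_of_ciInf_lt h
  ⟨a, a.2, ha⟩

/-- The quotient seminorm. -/
def quotientSeminorm (p : Seminorm ℂ A) : Seminorm ℂ I.Quotient :=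
  Seminorm.ofSMulLE (I.quotientNorm p)
    (le_antisymm (by simpa using I.quotientNorm_le p (map_zero I.proj)) (I.quotientNorm_nonneg p 0))
    (fun y z => by
      refine le_of_forall_pos_lt_add fun ε hε => ?_
      obtain ⟨a, rfl, ha⟩ := I.exists_lt_of_quotientNorm_lt
        (lt_add_of_pos_right (I.quotientNorm p y) (half_pos hε))
      obtain ⟨b, rfl, hb⟩ := I.exists_lt_of_quotientNorm_lt
        (lt_add_of_pos_right (I.quotientNorm p z) (half_pos hε))
      have h1 := I.quotientNorm_le p (map_add I.proj a b)
      have h2 := map_add_le_add p a b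
      linarith)
    (fun c y => by
      have := I.nonempty_fiber y
      rw [quotientNorm, quotientNorm, Real.mul_iInf_of_nonneg (norm_nonneg c)]
      refine le_ciInf fun a => ?_
      refine (I.quotientNorm_le p (a := c • (a : A)) ?_).trans_eq (map_smul_eq_mul p c (a : A))
      rw [map_smul, a.2])

theorem quotientSeminorm_apply_le (p : Seminorm ℂ A) (a : A) :
    I.quotientSeminorm p (I.proj a) ≤ p a := I.quotientNorm_le p rfl

theorem exists_lt_of_quotientSeminorm_lt {p : Seminorm ℂ A} {y : I.Quotient} {r : ℝ}
    (h : I.quotientSeminorm p y < r) : ∃ a, I.proj a = y ∧ p a < r :=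
  I.exists_lt_of_quotientNorm_lt h

theorem quotientSeminorm_mono {p q : Seminorm ℂ A} (h : p ≤ q) :
    I.quotientSeminorm p ≤ I.quotientSeminorm q := fun y =>
  le_of_forall_gt fun r hr => by
    obtain ⟨a, rfl, ha⟩ := I.exists_lt_of_quotientSeminorm_lt hr
    exact (I.quotientSeminorm_apply_le p a).trans_lt ((h a).trans_lt ha)

/-- For the hard inequality, let `d = a* a`, let `c` be a nearly optimal lift of its class, and let
`v` in `I` be an approximate unit for `c - d`. Then `a - a v` is another lift of the class of `a`,
and `p (a - a v) ^ 2 ≤ p (d - d v) ≤ p (c - c v) + ε / 2 ≤ p c + ε / 2`. -/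
theorem isCStarSeminorm_quotientSeminorm [IsScalarTower ℂ A A] [SMulCommClass ℂ A A]
    [StarModule ℂ A] {p : Seminorm ℂ A} (hp : IsCStarSeminorm p) :
    IsCStarSeminorm (I.quotientSeminorm p) := by
  have hmul : ∀ y z, I.quotientSeminorm p (y * z) ≤
      I.quotientSeminorm p y * I.quotientSeminorm p z := fun y z => by
    refine le_mul_of_forall_lt₀ fun r hr s hs => ?_
    obtain ⟨a, rfl, ha⟩ := I.exists_lt_of_quotientSeminorm_lt hr
    obtain ⟨b, rfl, hb⟩ := I.exists_lt_of_quotientSeminorm_lt hs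
    rw [← proj_mul]
    refine (I.quotientSeminorm_apply_le p _).trans ((hp.mul_le a b).trans ?_)
    exact mul_le_mul ha.le hb.le (apply_nonneg _ _) ((apply_nonneg _ _).trans ha.le)
  have hstar : ∀ y, I.quotientSeminorm p (star y) ≤ I.quotientSeminorm p y := fun y =>
    le_of_forall_gt fun r hr => by
      obtain ⟨a, rfl, ha⟩ := I.exists_lt_of_quotientSeminorm_lt hr
      rw [← proj_star]
      refine (I.quotientSeminorm_apply_le p _).trans_lt ?_
      rwa [hp.map_star]
  refine ⟨hmul, fun y => le_antisymm ?_ (le_of_forall_pos_le_add fun ε hε => ?_)⟩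
  · rw [sq]
    exact (hmul _ _).trans (mul_le_mul_of_nonneg_right (hstar y) (apply_nonneg _ _))
  · obtain ⟨c, hc, hcr⟩ := I.exists_lt_of_quotientSeminorm_lt
      (lt_add_of_pos_right (I.quotientSeminorm p (star y * y)) (half_pos hε))
    obtain ⟨a, rfl⟩ := I.proj_surjective y
    rw [← proj_star, ← proj_mul] at hc hcr ⊢
    have hx : c - star a * a ∈ I.toSubspace := proj_eq_proj.1 hc
    set d := star a * a with hd
    obtain ⟨v, hvI, hvs, -, hv2, hv⟩ := hp.exists_approximateUnit I.toNonUnitalStarSubalgebra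
      hx (half_pos hε)
    have hproj : I.proj (a - a * v) = I.proj a := proj_eq_proj.2 (by
      rw [sub_sub_cancel_left]; exact I.toSubspace.neg_mem (I.mul_mem_left a hvI))
    have e : star (a - a * v) * (a - a * v) = (d - d * v) - v * (d - d * v) := by
      rw [star_sub, star_mul, hvs, hd]; noncomm_ring
    have h1 : I.quotientSeminorm p (I.proj a) ^ 2 ≤ p (d - d * v) := by
      calc I.quotientSeminorm p (I.proj a) ^ 2 ≤ p (a - a * v) ^ 2 := by
            rw [← hproj]
            exact pow_le_pow_left₀ (apply_nonneg _ _) (I.quotientSeminorm_apply_le p _) 2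
        _ = p ((d - d * v) - v * (d - d * v)) := by rw [← hp.star_mul_self, e]
        _ ≤ _ := hv2 _
    have h2 : p (c - c * v) ≤ p c := by
      rw [← hp.map_star, ← hp.map_star c, star_sub, star_mul, hvs]; exact hv2 _
    have h3 : d - d * v = (c - c * v) - ((c - d) - (c - d) * v) := by noncomm_ring
    have h4 := map_sub_le_add p (c - c * v) ((c - d) - (c - d) * v)
    rw [← h3] at h4
    linarith

end ClosedStarIdeal

/-! ### Topology and completeness of the quotient -/

namespace ClosedStarIdeal

variable {A : Type*} [NonUnitalRing A] [StarRing A] [Module ℂ A] [UniformSpace A]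
  [IsTopologicalStarAlgebra A] (I : ClosedStarIdeal A)

theorem continuous_quotientSeminorm {p : Seminorm ℂ A} (hp : Continuous p) :
    Continuous (I.quotientSeminorm p) :=
  I.isOpenQuotientMap_proj.isQuotientMap.continuous_iff.2 <|
    Seminorm.continuous_of_le (p := (I.quotientSeminorm p).comp I.proj) hp
      (I.quotientSeminorm_apply_le p)

theorem withSeminorms_quotientSeminorm {ι : Type*} [Nonempty ι] {p : ι → Seminorm ℂ A}
    (hw : WithSeminorms p) (hd : Directed (· ≤ ·) p) :
    WithSeminorms (fun i => I.quotientSeminorm (p i)) := by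
  refine withSeminorms_of_exists_ball_subset
    (fun i => I.continuous_quotientSeminorm (hw.continuous_seminorm i)) fun U hU => ?_
  have h1 : I.proj ⁻¹' U ∈ nhds (0 : A) :=
    I.isOpenQuotientMap_proj.continuous.continuousAt (by rwa [map_zero])
  obtain ⟨i, r, hr, h⟩ := hw.exists_ball_subset hd h1
  refine ⟨i, r, hr, fun y hy => ?_⟩
  obtain ⟨a, rfl, ha⟩ := I.exists_lt_of_quotientSeminorm_lt hy
  exact h a ha

theorem directed_quotientSeminorm {ι : Type*} {p : ι → Seminorm ℂ A} (hd : Directed (· ≤ ·) p) :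
    Directed (· ≤ ·) fun i => I.quotientSeminorm (p i) :=
  fun i j => let ⟨k, hi, hj⟩ := hd i j
  ⟨k, I.quotientSeminorm_mono hi, I.quotientSeminorm_mono hj⟩

theorem t2Space_quotient : T2Space I.Quotient :=
  have : IsClosed (I.toSubspace : Set A) := I.isClosed
  inferInstanceAs (T2Space (A ⧸ I.toSubspace))

/-- First countability is what lets completeness pass to the quotient group; this is where the
Fréchet hypothesis enters. -/
theorem completeSpace_quotient [CompleteSpace A] [FirstCountableTopology A] :
    CompleteSpace I.Quotient := by
  have h := QuotientAddGroup.completeSpace_right A I.toSubspace.toAddSubgroup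
  have e : (inferInstanceAs (UniformSpace I.Quotient)) =
      IsTopologicalAddGroup.rightUniformSpace I.Quotient := UniformSpace.replaceTopology_eq _ rfl
  exact Eq.mpr (congrArg (fun u => @CompleteSpace I.Quotient u) e) h

end ClosedStarIdeal

/-! ### Extending seminorms and functionals to the completion -/

namespace StarCompletion

open UniformSpace

variable {B : Type*} [NonUnitalRing B] [StarRing B] [Module ℂ B] [UniformSpace B]
  [IsTopologicalStarAlgebra B]

theorem isCStarSeminorm_of_comp {p : Seminorm ℂ B} (hp : IsCStarSeminorm p)
    {q : Seminorm ℂ (StarCompletion B)} (hq : Continuous q) (hqp : ∀ b, q (of B b) = p b) :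
    IsCStarSeminorm q where
  mul_le x y := by
    refine induction_on₂ (P := fun x y => q (x * y) ≤ q x * q y) x y
      (isClosed_le (by fun_prop) (by fun_prop)) fun a b => ?_
    rw [← of_mul, hqp, hqp, hqp]; exact hp.mul_le a b
  star_mul_self x := by
    refine induction_on (P := fun x => q (star x * x) = q x ^ 2) x
      (isClosed_eq (by fun_prop) (by fun_prop)) fun a => ?_
    rw [← of_star, ← of_mul, hqp, hqp]; exact hp.star_mul_self a

theorem exists_seminorm_extension {p : Seminorm ℂ B} (hp : Continuous p) :
    ∃ q : Seminorm ℂ (StarCompletion B), Continuous q ∧ ∀ b, q (of B b) = p b := by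
  have hu : UniformContinuous p :=
    Seminorm.uniformContinuous_of_continuousAt_zero hp.continuousAt
  let φ : StarCompletion B → ℝ := Completion.extension p
  have hc : Continuous φ := Completion.continuous_extension
  have hφ : ∀ b, φ (of B b) = p b := Completion.extension_coe hu
  refine ⟨Seminorm.of φ (fun x y => ?_) (fun c x => ?_), hc, hφ⟩
  · refine induction_on₂ (P := fun x y => φ (x + y) ≤ φ x + φ y) x y
      (isClosed_le (by fun_prop) (by fun_prop)) fun a b => ?_
    rw [← map_add, hφ, hφ, hφ]; exact map_add_le_add p a b
  · refine induction_on (P := fun x => φ (c • x) = ‖c‖ * φ x) x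
      (isClosed_eq (by fun_prop) (by fun_prop)) fun a => ?_
    rw [← of_smul, hφ, hφ]; exact map_smul_eq_mul p c a

theorem exists_functional_extension (k : B →L[ℂ] ℂ) :
    ∃ K : StarCompletion B →L[ℂ] ℂ, ∀ b, K (of B b) = k b := by
  have hu : UniformContinuous k := uniformContinuous_addMonoidHom_of_continuous k.continuous
  let φ : StarCompletion B → ℂ := Completion.extension k
  have hc : Continuous φ := Completion.continuous_extension
  have hφ : ∀ b, φ (of B b) = k b := Completion.extension_coe hu
  refine ⟨⟨⟨⟨φ, fun x y => ?_⟩, fun c x => ?_⟩, hc⟩, hφ⟩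
  · refine induction_on₂ (P := fun x y => φ (x + y) = φ x + φ y) x y
      (isClosed_eq (by fun_prop) (by fun_prop)) fun a b => ?_
    rw [← map_add, hφ, hφ, hφ, map_add]
  · refine induction_on (P := fun x => φ (c • x) = c • φ x) x
      (isClosed_eq (by fun_prop) (by fun_prop)) fun a => ?_
    rw [← of_smul, hφ, hφ, map_smul]

theorem isLocallyCStarAlgebra {ι : Type*} [Nonempty ι] {p : ι → Seminorm ℂ B}
    (hp : ∀ i, IsCStarSeminorm (p i)) (hw : WithSeminorms p) (hd : Directed (· ≤ ·) p) :
    IsLocallyCStarAlgebra (StarCompletion B) := by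
  choose q hq hqp using fun i => exists_seminorm_extension (hw.continuous_seminorm i)
  refine .of_directed (p := q) (fun i => isCStarSeminorm_of_comp (hp i) (hq i) (hqp i))
    (fun i j => ?_) (withSeminorms_of_exists_ball_subset hq fun U hU => ?_)
  · obtain ⟨k, hik, hjk⟩ := hd i j
    have key : ∀ l, p l ≤ p k → q l ≤ q k := fun l h x =>
      induction_on (P := fun x => q l x ≤ q k x) x (isClosed_le (hq l) (hq k)) fun b => by
        rw [hqp, hqp]; exact h b
    exact ⟨k, key i hik, key j hjk⟩
  · obtain ⟨T, hT, hTc, hTU⟩ := exists_mem_nhds_isClosed_subset hU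
    have h1 : of B ⁻¹' T ∈ nhds (0 : B) :=
      (continuous_of B).continuousAt (by rwa [map_zero])
    obtain ⟨i, r, hr, h⟩ := hw.exists_ball_subset hd h1
    refine ⟨i, r, hr, fun x hx => hTU ?_⟩
    have ho : IsOpen {x | q i x < r} := isOpen_lt (hq i) continuous_const
    refine closure_minimal ?_ hTc
      ((isDenseInducing_of B).dense.open_subset_closure_inter ho hx)
    rintro _ ⟨hb, b, rfl⟩
    exact h b (by rw [← hqp]; exact hb)

end StarCompletion

/-! ### The two dense quotient maps -/

namespace ClosedStarIdeal

variable {A : Type*} [NonUnitalRing A] [StarRing A] [Module ℂ A] [UniformSpace A]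
  [IsTopologicalStarAlgebra A] (I : ClosedStarIdeal A)

/-- The quotient map as a continuous linear map. -/
def projL : A →L[ℂ] I.Quotient := ⟨I.proj, I.isOpenQuotientMap_proj.continuous⟩

/-- The canonical map from the algebra into the completion of the quotient. -/
def projCompletionL : A →L[ℂ] StarCompletion I.Quotient :=
  ⟨{ toFun := fun a => StarCompletion.of I.Quotient (I.proj a)
     map_add' := fun a b => by rw [map_add, map_add]
     map_smul' := fun c a => by rw [map_smul, StarCompletion.of_smul, RingHom.id_apply] },
    (StarCompletion.continuous_of _).comp I.isOpenQuotientMap_proj.continuous⟩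

theorem proj_eq_zero {x : A} (hx : x ∈ I.toSubspace) : I.proj x = 0 :=
  (Submodule.Quotient.mk_eq_zero _).2 hx

theorem exists_quotient_functional (f : A →L[ℂ] ℂ) (hf : ∀ x ∈ I.toSubspace, f x = 0) :
    ∃ k : I.Quotient →L[ℂ] ℂ, ∀ a, k (I.proj a) = f a := by
  let k : I.Quotient →ₗ[ℂ] ℂ := I.toSubspace.liftQ f.toLinearMap hf
  have hk : ∀ a, k (I.proj a) = f a := fun a => I.toSubspace.liftQ_apply _ a
  exact ⟨⟨k, I.isOpenQuotientMap_proj.isQuotientMap.continuous_iff.2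
    (f.continuous.congr fun a => (hk a).symm)⟩, hk⟩

theorem isDenseQuotientMap_projL : I.IsDenseQuotientMap I.projL where
  map_star_mul _ := rfl
  denseRange := I.proj_surjective.denseRange
  map_mem _ hx := I.proj_eq_zero hx
  exists_factor f hf :=
    let ⟨k, hk⟩ := I.exists_quotient_functional f hf
    ⟨k, ContinuousLinearMap.ext hk⟩

theorem isDenseQuotientMap_projCompletionL : I.IsDenseQuotientMap I.projCompletionL where
  map_star_mul a := by
    change StarCompletion.of I.Quotient (star (I.proj a) * I.proj a) = _
    rw [StarCompletion.of_mul, StarCompletion.of_star]; rfl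
  denseRange := (StarCompletion.isDenseInducing_of I.Quotient).dense.comp
    I.proj_surjective.denseRange (StarCompletion.continuous_of _)
  map_mem x hx := by
    change StarCompletion.of I.Quotient (I.proj x) = 0
    rw [I.proj_eq_zero hx, map_zero]
  exists_factor f hf := by
    obtain ⟨k, hk⟩ := I.exists_quotient_functional f hf
    obtain ⟨K, hK⟩ := StarCompletion.exists_functional_extension k
    exact ⟨K, ContinuousLinearMap.ext fun a => (hK _).trans (hk a)⟩

end ClosedStarIdeal

/-! ### The quotient and its completion as locally `C*`-algebras -/

namespace ClosedStarIdeal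

variable {A : Type*} [NonUnitalRing A] [StarRing A] [Module ℂ A] [UniformSpace A]

theorem isLocallyCStarAlgebra_completion [hA : IsLocallyCStarAlgebra A] (I : ClosedStarIdeal A) :
    IsLocallyCStarAlgebra (StarCompletion I.Quotient) := by
  obtain ⟨Γ, hne, hd, hΓ, hw⟩ := hA.exists_seminorms
  have : Nonempty Γ := hne.to_subtype
  have hd' : Directed (· ≤ ·) fun p : Γ => (p : Seminorm ℂ A) := directedOn_iff_directed.1 hd
  exact StarCompletion.isLocallyCStarAlgebra
    (fun p : Γ => I.isCStarSeminorm_quotientSeminorm (hΓ p p.2))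
    (I.withSeminorms_quotientSeminorm hw hd') (I.directed_quotientSeminorm hd')

theorem isFrechetLocallyCStarAlgebra_quotient [hA : IsFrechetLocallyCStarAlgebra A]
    (I : ClosedStarIdeal A) : IsFrechetLocallyCStarAlgebra I.Quotient := by
  obtain ⟨p, hp, hw⟩ := hA.exists_seq
  have : FirstCountableTopology A := hw.firstCountableTopology
  have := I.completeSpace_quotient
  have := I.t2Space_quotient
  -- A sequence of seminorms need not be directed; its partial suprema are, and they define the same
  -- topology.
  have hd : Directed (· ≤ ·) fun n => (Finset.Iic n).sup p :=
    Monotone.directed_le fun m n h => Finset.sup_mono (Finset.Iic_subset_Iic.2 h)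
  have hC := fun n => I.isCStarSeminorm_quotientSeminorm
    (isCStarSeminorm_finset_sup hp (Finset.Iic n))
  have hW := I.withSeminorms_quotientSeminorm hw.partial_sups hd
  have := IsLocallyCStarAlgebra.of_directed hC (I.directed_quotientSeminorm hd) hW
  exact ⟨⟨_, hC, hW⟩⟩

end ClosedStarIdeal

end

theorem mainTheorem5 (A : Type*) [NonUnitalRing A] [StarRing A] [Module ℂ A] [UniformSpace A]
    [IsLocallyCStarAlgebra A] (I : ClosedStarIdeal A) :
    IsLocallyCStarAlgebra I.toNonUnitalStarSubalgebra ∧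
    IsLocallyCStarAlgebra (StarCompletion I.Quotient) ∧
    (IsScattered A ↔
      IsScattered I.toNonUnitalStarSubalgebra ∧ IsScattered (StarCompletion I.Quotient)) ∧
    (IsFrechetLocallyCStarAlgebra A →
      IsFrechetLocallyCStarAlgebra I.Quotient ∧
      (IsScattered A ↔
        IsScattered I.toNonUnitalStarSubalgebra ∧ IsScattered I.Quotient)) := by
  have := I.isLocallyCStarAlgebra_completion
  refine ⟨inferInstance, this, I.isDenseQuotientMap_projCompletionL.isScattered_iff, fun hF => ?_⟩
  have hQ := I.isFrechetLocallyCStarAlgebra_quotient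
  exact ⟨hQ, I.isDenseQuotientMap_projL.isScattered_iff⟩
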